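/- **Notation.** For an integer $n$ put $\{n\}=\frac{q^{2n}-1}{q^2-1}\in\mathbb{Q}(q)$. For $x\in\mathbb{Q}$ with continued fraction $x=[a_1,\dots,a_{2m}]$ of even length ($a_1\in\mathbb{Z}$, $a_i\ge 1$ for $i\ge 2$), the $q$-rational is $$\{x\}=\{a_1\}+\cfrac{q^{2a_1}}{\{a_2\}_{q^{-1}}+\cfrac{q^{-2a_2}}{\{a_3\}+\cfrac{q^{2a_3}}{\ddots+\cfrac{q^{2a_{2m-1}}}{\{a_{2m}\}_{q^{-1}}}}}},$$ where $\{n\}_{q^{-1}}$ is $\{n\}$ with $q$ replaced by $q^{-1}$. Put $\delta_x=\{x\}-\{x-1\}$. Let $R=\mathbb{Q}(q)[\nu_x]$ with $\nu_x^2=\delta_x^{-1}$ (more generally, $R$ may be any commutative $\mathbb{Q}(q)$-algebra with an element $\nu_x$ such that $\nu_x^2\delta_x=1$), and put $$a=q\nu_x\delta_x,\qquad c_r=\frac{aq^{-r}-a^{-1}q^r}{q-q^{-1}},\qquad \mu_k=c_0c_1\cdots c_{k-1}\,\frac{q^{k(k-1)/2}}{\{k\}\{k-1\}\cdots\{1\}}\quad(\mu_0=1).$$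 Let $x\mathrm{Web}$ be the $R$-linear pivotal monoidal category whose objects are words in upward and downward arrows labelled by positive integers (arrows labelled $0$ are erased, webs with a negative label are zero) and whose morphisms are generated by merges $k\otimes l\to k+l$ and splits $k+l\to k\otimes l$ of upward strands, and by caps and cups of both orientations, up to planar isotopy, subject to: associativity of merges and of splits; the digon relation (splitting $k+l$ into $k,l$ and merging again is $q^{-kl}\frac{\{k+l\}\cdots\{l+1\}}{\{k\}\cdots\{1\}}$ times the identity); the square switch relation on two upward strands $(k,l)$, $[(k,l)\to(k-1,l+1)\to(k,l)]-[(k,l)\to(k+1,l-1)\to(k,l)]=q^{1-k+l}\{k-l\}\,\mathrm{id}$; the four Serre relations for ladders on three upward strands; the circle labelled $k$, in either orientation, is $\mu_k$; a sideway digon with edges $1,2$ on a strand labelled $1$, on either side, is $c_1$ times the strand; and the mixed square with edges labelled $1,2,1,2$ on $1{\uparrow}\,1{\downarrow}$ equals $\mathrm{id}+c_2\cdot(\text{cap followed by cup})$, together with its mirror image. Let $\mathcal{S}_2^x(1,1,0)=\mathrm{END}_{x\mathrm{Web}}\big(\bigoplus_{k\ge 0}(k{\uparrow},k{\downarrow})\big)$,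 i.e. the (locally unital) $R$-algebra $\bigoplus_{k,l\ge 0}\mathrm{Hom}_{x\mathrm{Web}}\big((k{\uparrow},k{\downarrow}),(l{\uparrow},l{\downarrow})\big)$ of matrices with finitely many non-zero entries. For $k\ge 0$ let $f_k\in\mathcal{S}_2^x(1,1,0)$ be the $k$-labelled cap $(k{\uparrow},k{\downarrow})\to\emptyset$ followed by the $k$-labelled cup $\emptyset\to(k{\uparrow},k{\downarrow})$. **Proposition.** Let $x\in\mathbb{Q}$ with $x\notin\mathbb{N}=\{0,1,2,\dots\}$. 1. For every $k$, the cup followed by the cap is $\mu_k\,\mathrm{id}_\emptyset$, and $\mu_k$ is invertible in $R$. One has $f_kf_l=\delta_{k,l}\,\mu_kf_k$, so that the elements $e_k=f_k/\mu_k$, $k\ge 0$, are orthogonal idempotents: $e_ke_l=\delta_{k,l}e_k$. 2. Let $A$ be a quotient algebra of $\mathcal{S}_2^x(1,1,0)$, with projection $\pi$, in which the identity of the empty web is not torsion (if $r\in R$ and $r\,\pi(\mathrm{id}_\emptyset)=0$, then $r=0$). Then the elements $\pi(e_k)$, $k\ge 0$, are linearly independent over $R$. 3. No non-zero quotient algebra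 of $\mathcal{S}_2^x(1,1,0)$ is finite-dimensional (finitely generated as an $R$-module). In particular, $\mathcal{S}_2^x(1,1,0)$ has no non-zero finite-dimensional torsion-free quotient. -/

import Mathlib

open CategoryTheory MonoidalCategory DirectSum

universe u v

noncomputable section

namespace QWeb

/-! ### Quantum integers and `q`-rationals (normalised in the variable `q ^ 2`) -/

/-- The indeterminate `q` of the field `ℚ(q)`. -/
def q : RatFunc ℚ := RatFunc.X

/-- `{n}`, evaluated at the value `t` of the indeterminate:
`{n}_t = (t ^ (2n) - 1) / (t ^ 2 - 1)`. -/
def qInt (t : RatFunc ℚ) (n : ℤ) : RatFunc ℚ := (t ^ (2 * n) - 1) / (t ^ 2 - 1)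

/-- The Gaussian binomial `{n}{n-1}⋯{n-k+1} / ({k}{k-1}⋯{1})`. -/
def qBinom (k : ℕ) (n : ℤ) : RatFunc ℚ :=
  ∏ i ∈ Finset.range k, qInt q (n - i) / qInt q (i + 1)

theorem evenCF_decreasing (x : ℚ)
    (h : ¬ ((x - (⌈x⌉ - 1 : ℤ))⁻¹ = (⌊(x - (⌈x⌉ - 1 : ℤ))⁻¹⌋ : ℚ))) :
    (((x - (⌈x⌉ - 1 : ℤ))⁻¹ - ⌊(x - (⌈x⌉ - 1 : ℤ))⁻¹⌋)⁻¹).den < x.den := by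
  have key : ∀ r : ℚ, 0 < r → r.num = (r⁻¹.den : ℤ) := by
    intro r hr
    have h1 : 0 < r.num := Rat.num_pos.mpr hr
    rw [Rat.den_inv_of_ne_zero hr.ne']
    omega
  have hy : 0 < x - (⌈x⌉ - 1 : ℤ) := by
    have := Int.ceil_lt_add_one x
    push_cast
    linarith
  set y := (x - (⌈x⌉ - 1 : ℤ))⁻¹ with hydef
  have hypos : 0 < y := inv_pos.mpr hy
  have hfr : 0 < y - ⌊y⌋ := by
    have h1 := Int.floor_le y
    rcases h1.lt_or_eq with h2 | h2
    · linarith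
    · exact absurd h2.symm h
  have hlt : y - ⌊y⌋ < 1 := by
    have := Int.lt_floor_add_one y
    linarith
  have hden : ∀ (z : ℚ) (n : ℤ), (z - n).den = z.den := fun z n => by
    simp
  have hyden : (y.den : ℤ) ≤ x.den := by
    rw [← key _ hy, ← hden x (⌈x⌉ - 1)]
    have hle : x - (⌈x⌉ - 1 : ℤ) ≤ 1 := by
      have := Int.le_ceil x
      push_cast
      linarith
    exact Rat.num_le_denom_iff.mpr hle
  have h2 : ((y - ⌊y⌋)⁻¹.den : ℤ) < y.den := by
    rw [← key _ hfr, ← hden y ⌊y⌋]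
    exact Rat.num_lt_denom_iff.mpr hlt
  omega

/-- The continued fraction expansion `[a₁, a₂, …, a₂ₘ]` of `x` of even length, with `aᵢ ≥ 1` for
`i ≥ 2`.  In odd positions the partial quotient `⌈x⌉ - 1` leaves a remainder in `(0, 1]`, so that
the expansion can only stop after an even position. -/
def evenCF (x : ℚ) : List ℤ :=
  if (x - (⌈x⌉ - 1 : ℤ))⁻¹ = (⌊(x - (⌈x⌉ - 1 : ℤ))⁻¹⌋ : ℚ) then
    [⌈x⌉ - 1, ⌊(x - (⌈x⌉ - 1 : ℤ))⁻¹⌋]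
  else
    (⌈x⌉ - 1) :: ⌊(x - (⌈x⌉ - 1 : ℤ))⁻¹⌋ ::
      evenCF ((x - (⌈x⌉ - 1 : ℤ))⁻¹ - ⌊(x - (⌈x⌉ - 1 : ℤ))⁻¹⌋)⁻¹
termination_by x.den
decreasing_by exact evenCF_decreasing x ‹_›

/-- The `q`-deformed continued fraction of a list of even length:
`{a₁} + q^(2a₁) / ({a₂}_{1/q} + q^(-2a₂) / ({a₃} + q^(2a₃) / (⋱ + q^(2aₙ₋₁) / {aₙ}_{1/q})))`.
(Lists of odd length do not occur and get the value `0`.) -/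
def qCF : List ℤ → RatFunc ℚ
  | [] => 0
  | [_] => 0
  | [a, b] => qInt q a + q ^ (2 * a) / qInt q⁻¹ b
  | a :: b :: c :: l =>
      qInt q a + q ^ (2 * a) / (qInt q⁻¹ b + q ^ (-2 * b) / qCF (c :: l))

/-- The `q`-rational `{x}`. -/
def qRat (x : ℚ) : RatFunc ℚ := qCF (evenCF x)

/-- `δ_x = {x} - {x - 1}`. -/
def qDelta (x : ℚ) : RatFunc ℚ := qRat x - qRat (x - 1)

/-! ### Objects and formal web expressions -/

/-- Words in upward and downward arrows labelled by positive integers. -/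
inductive WebObj : Type
  | one : WebObj
  | up (k : ℕ+) : WebObj
  | down (k : ℕ+) : WebObj
  | tensor (X Y : WebObj) : WebObj

local infixr:70 " ⊗ᵒ " => WebObj.tensor

/-- The upward strand labelled `k`; strands labelled `0` are erased. -/
def up : ℕ → WebObj
  | 0 => WebObj.one
  | k + 1 => WebObj.up k.succPNat

/-- The downward strand labelled `k`; strands labelled `0` are erased. -/
def dn : ℕ → WebObj
  | 0 => WebObj.one
  | k + 1 => WebObj.down k.succPNat

/-- Formal `R`-linear combinations of composites and juxtapositions of the elementary webs:
the two kinds of trivalent vertices, and caps and cups of both orientations. -/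
inductive WebTm (R : Type u) : WebObj → WebObj → Type u
  | id (X : WebObj) : WebTm R X X
  | comp {X Y Z : WebObj} (f : WebTm R X Y) (g : WebTm R Y Z) : WebTm R X Z
  | tensor {X Y X' Y' : WebObj} (f : WebTm R X Y) (g : WebTm R X' Y') :
      WebTm R (X ⊗ᵒ X') (Y ⊗ᵒ Y')
  | assoc (X Y Z : WebObj) : WebTm R ((X ⊗ᵒ Y) ⊗ᵒ Z) (X ⊗ᵒ (Y ⊗ᵒ Z))
  | assocInv (X Y Z : WebObj) : WebTm R (X ⊗ᵒ (Y ⊗ᵒ Z)) ((X ⊗ᵒ Y) ⊗ᵒ Z)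
  | lunit (X : WebObj) : WebTm R (WebObj.one ⊗ᵒ X) X
  | lunitInv (X : WebObj) : WebTm R X (WebObj.one ⊗ᵒ X)
  | runit (X : WebObj) : WebTm R (X ⊗ᵒ WebObj.one) X
  | runitInv (X : WebObj) : WebTm R X (X ⊗ᵒ WebObj.one)
  | zero (X Y : WebObj) : WebTm R X Y
  | add {X Y : WebObj} (f g : WebTm R X Y) : WebTm R X Y
  | smul {X Y : WebObj} (r : R) (f : WebTm R X Y) : WebTm R X Y
  /-- two upward strands `k`, `l` merge into one labelled `m = k + l` -/
  | merge (k l m : ℕ) (h : k + l = m) : WebTm R (up k ⊗ᵒ up l) (up m)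
  /-- an upward strand `m = k + l` splits into `k`, `l` -/
  | split (k l m : ℕ) (h : k + l = m) : WebTm R (up m) (up k ⊗ᵒ up l)
  /-- the cap oriented from left to right -/
  | capR (k : ℕ) : WebTm R (up k ⊗ᵒ dn k) WebObj.one
  /-- the cup oriented from left to right -/
  | cupR (k : ℕ) : WebTm R WebObj.one (dn k ⊗ᵒ up k)
  /-- the cap oriented from right to left -/
  | capL (k : ℕ) : WebTm R (dn k ⊗ᵒ up k) WebObj.one
  /-- the cup oriented from right to left -/
  | cupL (k : ℕ) : WebTm R WebObj.one (up k ⊗ᵒ dn k)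

namespace WebTm

local infixr:80 " ≫ᵗ " => WebTm.comp
local infixr:85 " ⊗ᵗ " => WebTm.tensor

variable {R : Type u}

/-- Transfer of `s` from the left strand to the right one: `(k' + s, l) → (k', l + s)`. -/
def rungR (s k' l : ℕ) : WebTm R (up (k' + s) ⊗ᵒ up l) (up k' ⊗ᵒ up (l + s)) :=
  (split k' s (k' + s) rfl ⊗ᵗ id (up l)) ≫ᵗ assoc _ _ _ ≫ᵗ
    (id (up k') ⊗ᵗ merge s l (l + s) (Nat.add_comm s l))

/-- Transfer of `s` from the right strand to the left one: `(k, l' + s) → (k + s, l')`. -/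
def rungL (s k l' : ℕ) : WebTm R (up k ⊗ᵒ up (l' + s)) (up (k + s) ⊗ᵒ up l') :=
  (id (up k) ⊗ᵗ split s l' (l' + s) (Nat.add_comm s l')) ≫ᵗ assocInv _ _ _ ≫ᵗ
    (merge k s (k + s) rfl ⊗ᵗ id (up l'))

/-- `(k, l) → (k - 1, l + 1) → (k, l)`; it is zero if `k = 0` (negative label). -/
def ladderRL : (k l : ℕ) → WebTm R (up k ⊗ᵒ up l) (up k ⊗ᵒ up l)
  | 0, _ => zero _ _
  | k + 1, l => rungR 1 k l ≫ᵗ rungL 1 k l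

/-- `(k, l) → (k + 1, l - 1) → (k, l)`; it is zero if `l = 0` (negative label). -/
def ladderLR : (k l : ℕ) → WebTm R (up k ⊗ᵒ up l) (up k ⊗ᵒ up l)
  | _, 0 => zero _ _
  | k, l + 1 => rungL 1 k l ≫ᵗ rungR 1 k l

/-- A two-strand web placed on the left two of three strands. -/
def onLeft {A B C D : WebObj} (f : WebTm R (A ⊗ᵒ B) (C ⊗ᵒ D)) (E : WebObj) :
    WebTm R ((A ⊗ᵒ B) ⊗ᵒ E) ((C ⊗ᵒ D) ⊗ᵒ E) := f ⊗ᵗ id E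

/-- A two-strand web placed on the right two of three strands. -/
def onRight {A B C D : WebObj} (E : WebObj) (f : WebTm R (A ⊗ᵒ B) (C ⊗ᵒ D)) :
    WebTm R ((E ⊗ᵒ A) ⊗ᵒ B) ((E ⊗ᵒ C) ⊗ᵒ D) :=
  assoc _ _ _ ≫ᵗ (id E ⊗ᵗ f) ≫ᵗ assocInv _ _ _

/-- `(k, l+1, r+1) → (k+2, l-1, r+1) → (k+2, l, r)`; it is zero if `l = 0` (negative label). -/
def serreEE : (k l r : ℕ) →
    WebTm R ((up k ⊗ᵒ up (l + 1)) ⊗ᵒ up (r + 1)) ((up (k + 2) ⊗ᵒ up l) ⊗ᵒ up r)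
  | _, 0, _ => zero _ _
  | k, l + 1, r => onLeft (rungL 2 k l) (up (r + 1)) ≫ᵗ onRight (up (k + 2)) (rungL 1 l r)

/-- `(k, l, r+2) → (k+1, l-1, r+2) → (k+1, l+1, r)`; it is zero if `l = 0` (negative label). -/
def serreEE' : (k l r : ℕ) →
    WebTm R ((up k ⊗ᵒ up l) ⊗ᵒ up (r + 2)) ((up (k + 1) ⊗ᵒ up (l + 1)) ⊗ᵒ up r)
  | _, 0, _ => zero _ _
  | k, l + 1, r => onLeft (rungL 1 k l) (up (r + 2)) ≫ᵗ onRight (up (k + 1)) (rungL 2 l r)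

/-- `(k+2, l, r) → (k+2, l-1, r+1) → (k, l+1, r+1)`; it is zero if `l = 0` (negative label). -/
def serreFF : (k l r : ℕ) →
    WebTm R ((up (k + 2) ⊗ᵒ up l) ⊗ᵒ up r) ((up k ⊗ᵒ up (l + 1)) ⊗ᵒ up (r + 1))
  | _, 0, _ => zero _ _
  | k, l + 1, r => onRight (up (k + 2)) (rungR 1 l r) ≫ᵗ onLeft (rungR 2 k l) (up (r + 1))

/-- `(k+1, l+1, r) → (k+1, l-1, r+2) → (k, l, r+2)`; it is zero if `l = 0` (negative label). -/
def serreFF' : (k l r : ℕ) →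
    WebTm R ((up (k + 1) ⊗ᵒ up (l + 1)) ⊗ᵒ up r) ((up k ⊗ᵒ up l) ⊗ᵒ up (r + 2))
  | _, 0, _ => zero _ _
  | k, l + 1, r => onRight (up (k + 1)) (rungR 2 l r) ≫ᵗ onLeft (rungR 1 k l) (up (r + 2))

/-- Rotation by a half turn, with the help of a cup and a cap. -/
def rotR {X X' Y Y' : WebObj} (coev : WebTm R WebObj.one (X' ⊗ᵒ X))
    (ev : WebTm R (Y ⊗ᵒ Y') WebObj.one) (f : WebTm R X Y) : WebTm R Y' X' :=
  lunitInv _ ≫ᵗ (coev ⊗ᵗ id Y') ≫ᵗ ((id X' ⊗ᵗ f) ⊗ᵗ id Y') ≫ᵗ assoc _ _ _ ≫ᵗ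
    (id X' ⊗ᵗ ev) ≫ᵗ runit _

/-- Rotation by a half turn in the other direction. -/
def rotL {X X' Y Y' : WebObj} (coev : WebTm R WebObj.one (X ⊗ᵒ X'))
    (ev : WebTm R (Y' ⊗ᵒ Y) WebObj.one) (f : WebTm R X Y) : WebTm R Y' X' :=
  runitInv _ ≫ᵗ (id Y' ⊗ᵗ coev) ≫ᵗ (id Y' ⊗ᵗ (f ⊗ᵗ id X')) ≫ᵗ assocInv _ _ _ ≫ᵗ
    (ev ⊗ᵗ id X') ≫ᵗ lunit _

/-- Two nested caps, given by an inner and an outer one. -/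
def nestCap {A A' B B' : WebObj} (outer : WebTm R (A ⊗ᵒ A') WebObj.one)
    (inner : WebTm R (B ⊗ᵒ B') WebObj.one) :
    WebTm R ((A ⊗ᵒ B) ⊗ᵒ (B' ⊗ᵒ A')) WebObj.one :=
  assoc _ _ _ ≫ᵗ (id A ⊗ᵗ (assocInv _ _ _ ≫ᵗ (inner ⊗ᵗ id A') ≫ᵗ lunit _)) ≫ᵗ outer

/-- Two nested cups, given by an inner and an outer one. -/
def nestCup {A A' B B' : WebObj} (outer : WebTm R WebObj.one (A ⊗ᵒ A'))
    (inner : WebTm R WebObj.one (B ⊗ᵒ B')) :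
    WebTm R WebObj.one ((A ⊗ᵒ B) ⊗ᵒ (B' ⊗ᵒ A')) :=
  outer ≫ᵗ (id A ⊗ᵗ (lunitInv _ ≫ᵗ (inner ⊗ᵗ id A') ≫ᵗ assoc _ _ _)) ≫ᵗ assocInv _ _ _

/-- Two upward strands labelled `1` that merge into one labelled `2`, which splits again. -/
def dumbbell : WebTm R (up 1 ⊗ᵒ up 1) (up 1 ⊗ᵒ up 1) :=
  merge 1 1 2 rfl ≫ᵗ split 1 1 2 rfl

/-- The strand `1` with a sideway digon on its right. -/
def sideDigonR : WebTm R (up 1) (up 1) :=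
  runitInv _ ≫ᵗ (id (up 1) ⊗ᵗ cupL 1) ≫ᵗ assocInv _ _ _ ≫ᵗ (dumbbell ⊗ᵗ id (dn 1)) ≫ᵗ
    assoc _ _ _ ≫ᵗ (id (up 1) ⊗ᵗ capR 1) ≫ᵗ runit _

/-- The strand `1` with a sideway digon on its left. -/
def sideDigonL : WebTm R (up 1) (up 1) :=
  lunitInv _ ≫ᵗ (cupR 1 ⊗ᵗ id (up 1)) ≫ᵗ assoc _ _ _ ≫ᵗ (id (dn 1) ⊗ᵗ dumbbell) ≫ᵗ
    assocInv _ _ _ ≫ᵗ (capL 1 ⊗ᵗ id (up 1)) ≫ᵗ lunit _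

/-- The `dumbbell` rotated by a quarter turn, so that its `2`-labelled edge points to the right. -/
def sideR : WebTm R (up 1 ⊗ᵒ dn 1) (dn 1 ⊗ᵒ up 1) :=
  lunitInv _ ≫ᵗ (cupR 1 ⊗ᵗ id (up 1 ⊗ᵒ dn 1)) ≫ᵗ assoc _ _ _ ≫ᵗ
    (id (dn 1) ⊗ᵗ (assocInv _ _ _ ≫ᵗ (dumbbell ⊗ᵗ id (dn 1)) ≫ᵗ assoc _ _ _ ≫ᵗ
      (id (up 1) ⊗ᵗ capR 1) ≫ᵗ runit _))

/-- The `dumbbell` rotated by a quarter turn, so that its `2`-labelled edge points to the left. -/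
def sideL : WebTm R (dn 1 ⊗ᵒ up 1) (up 1 ⊗ᵒ dn 1) :=
  runitInv _ ≫ᵗ (id (dn 1 ⊗ᵒ up 1) ⊗ᵗ cupL 1) ≫ᵗ assocInv _ _ _ ≫ᵗ
    ((assoc _ _ _ ≫ᵗ (id (dn 1) ⊗ᵗ dumbbell) ≫ᵗ assocInv _ _ _ ≫ᵗ
      (capL 1 ⊗ᵗ id (up 1)) ≫ᵗ lunit _) ⊗ᵗ id (dn 1))

end WebTm

/-! ### The web category -/

section Category

variable {R : Type u} [CommRing R] [Algebra (RatFunc ℚ) R]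

/-- `(a q^(-r) - a⁻¹ q^r) / (q - q⁻¹)`. -/
def aInt (a : Rˣ) (r : ℕ) : R :=
  (q - q⁻¹)⁻¹ • (q⁻¹ ^ r • (a : R) - q ^ r • ((a⁻¹ : Rˣ) : R))

/-- The value `μ_k` of the circle labelled `k`:
`μ_k = (∏_{i<k} (a q^(-i) - a⁻¹ q^i) / (q - q⁻¹)) * q^(k(k-1)/2) / ({k}{k-1}⋯{1})`. -/
def circleVal (a : Rˣ) (k : ℕ) : R :=
  (q ^ (k * (k - 1) / 2) / ∏ i ∈ Finset.range k, qInt q (i + 1)) •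
    ∏ i ∈ Finset.range k, aInt a i

local infixr:80 " ≫ᵗ " => WebTm.comp
local infixr:85 " ⊗ᵗ " => WebTm.tensor
local infixl:65 " +ᵗ " => WebTm.add
local infixr:90 " •ᵗ " => WebTm.smul

open WebTm in
/-- The relations between webs: the laws of an `R`-linear monoidal category, erasure of strands
labelled `0`, isotopy (zigzags and rotations of vertices), the relations between upward webs, and
the relations that involve both orientations.  Crossings are linear combinations of ladders and of
their rotations (for two strands labelled `1`: identity minus `q^±1` times the dumbbell), so the
braiding adds neither generators nor relations. -/
inductive WebRel (a : Rˣ) : {X Y : WebObj} → WebTm R X Y → WebTm R X Y → Prop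
  -- congruence
  | refl {X Y} (f : WebTm R X Y) : WebRel a f f
  | symm {X Y} {f g : WebTm R X Y} : WebRel a f g → WebRel a g f
  | trans {X Y} {f g h : WebTm R X Y} : WebRel a f g → WebRel a g h → WebRel a f h
  | comp_congr {X Y Z} {f f' : WebTm R X Y} {g g' : WebTm R Y Z} :
      WebRel a f f' → WebRel a g g' → WebRel a (f ≫ᵗ g) (f' ≫ᵗ g')
  | tensor_congr {X Y X' Y'} {f f' : WebTm R X Y} {g g' : WebTm R X' Y'} :
      WebRel a f f' → WebRel a g g' → WebRel a (f ⊗ᵗ g) (f' ⊗ᵗ g')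
  | add_congr {X Y} {f f' g g' : WebTm R X Y} :
      WebRel a f f' → WebRel a g g' → WebRel a (f +ᵗ g) (f' +ᵗ g')
  | smul_congr {X Y} (r : R) {f f' : WebTm R X Y} :
      WebRel a f f' → WebRel a (r •ᵗ f) (r •ᵗ f')
  -- category
  | id_comp {X Y} (f : WebTm R X Y) : WebRel a (id X ≫ᵗ f) f
  | comp_id {X Y} (f : WebTm R X Y) : WebRel a (f ≫ᵗ id Y) f
  | comp_assoc {W X Y Z} (f : WebTm R W X) (g : WebTm R X Y) (h : WebTm R Y Z) :
      WebRel a ((f ≫ᵗ g) ≫ᵗ h) (f ≫ᵗ (g ≫ᵗ h))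
  -- monoidal category
  | tensor_id (X Y : WebObj) : WebRel a (id X ⊗ᵗ id Y) (id (X ⊗ᵒ Y))
  | tensor_comp {X Y Z X' Y' Z'} (f : WebTm R X Y) (f' : WebTm R X' Y')
      (g : WebTm R Y Z) (g' : WebTm R Y' Z') :
      WebRel a ((f ⊗ᵗ f') ≫ᵗ (g ⊗ᵗ g')) ((f ≫ᵗ g) ⊗ᵗ (f' ≫ᵗ g'))
  | assoc_hom_inv (X Y Z : WebObj) : WebRel a (assoc X Y Z ≫ᵗ assocInv X Y Z) (WebTm.id _)
  | assoc_inv_hom (X Y Z : WebObj) : WebRel a (assocInv X Y Z ≫ᵗ assoc X Y Z) (WebTm.id _)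
  | lunit_hom_inv (X : WebObj) : WebRel a (lunit X ≫ᵗ lunitInv X) (WebTm.id _)
  | lunit_inv_hom (X : WebObj) : WebRel a (lunitInv X ≫ᵗ lunit X) (WebTm.id _)
  | runit_hom_inv (X : WebObj) : WebRel a (runit X ≫ᵗ runitInv X) (WebTm.id _)
  | runit_inv_hom (X : WebObj) : WebRel a (runitInv X ≫ᵗ runit X) (WebTm.id _)
  | assoc_nat {X Y X' Y' X'' Y''} (f : WebTm R X Y) (f' : WebTm R X' Y')
      (f'' : WebTm R X'' Y'') :
      WebRel a (((f ⊗ᵗ f') ⊗ᵗ f'') ≫ᵗ assoc Y Y' Y'') (assoc X X' X'' ≫ᵗ (f ⊗ᵗ (f' ⊗ᵗ f'')))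
  | lunit_nat {X Y} (f : WebTm R X Y) :
      WebRel a ((id WebObj.one ⊗ᵗ f) ≫ᵗ lunit Y) (lunit X ≫ᵗ f)
  | runit_nat {X Y} (f : WebTm R X Y) :
      WebRel a ((f ⊗ᵗ id WebObj.one) ≫ᵗ runit Y) (runit X ≫ᵗ f)
  | pentagon (W X Y Z : WebObj) :
      WebRel a ((assoc W X Y ⊗ᵗ id Z) ≫ᵗ assoc W (X ⊗ᵒ Y) Z ≫ᵗ (id W ⊗ᵗ assoc X Y Z))
        (assoc (W ⊗ᵒ X) Y Z ≫ᵗ assoc W X (Y ⊗ᵒ Z))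
  | triangle (X Y : WebObj) :
      WebRel a (assoc X WebObj.one Y ≫ᵗ (id X ⊗ᵗ lunit Y)) (runit X ⊗ᵗ id Y)
  -- linear structure
  | add_assoc {X Y} (f g h : WebTm R X Y) : WebRel a ((f +ᵗ g) +ᵗ h) (f +ᵗ (g +ᵗ h))
  | add_comm {X Y} (f g : WebTm R X Y) : WebRel a (f +ᵗ g) (g +ᵗ f)
  | zero_add {X Y} (f : WebTm R X Y) : WebRel a (zero X Y +ᵗ f) f
  | zero_smul {X Y} (f : WebTm R X Y) : WebRel a ((0 : R) •ᵗ f) (zero X Y)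
  | one_smul {X Y} (f : WebTm R X Y) : WebRel a ((1 : R) •ᵗ f) f
  | mul_smul {X Y} (r s : R) (f : WebTm R X Y) : WebRel a ((r * s) •ᵗ f) (r •ᵗ (s •ᵗ f))
  | add_smul {X Y} (r s : R) (f : WebTm R X Y) :
      WebRel a ((r + s) •ᵗ f) ((r •ᵗ f) +ᵗ (s •ᵗ f))
  | smul_add {X Y} (r : R) (f g : WebTm R X Y) :
      WebRel a (r •ᵗ (f +ᵗ g)) ((r •ᵗ f) +ᵗ (r •ᵗ g))
  | add_comp {X Y Z} (f g : WebTm R X Y) (h : WebTm R Y Z) :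
      WebRel a ((f +ᵗ g) ≫ᵗ h) ((f ≫ᵗ h) +ᵗ (g ≫ᵗ h))
  | comp_add {X Y Z} (f : WebTm R X Y) (g h : WebTm R Y Z) :
      WebRel a (f ≫ᵗ (g +ᵗ h)) ((f ≫ᵗ g) +ᵗ (f ≫ᵗ h))
  | smul_comp {X Y Z} (r : R) (f : WebTm R X Y) (g : WebTm R Y Z) :
      WebRel a ((r •ᵗ f) ≫ᵗ g) (r •ᵗ (f ≫ᵗ g))
  | comp_smul {X Y Z} (r : R) (f : WebTm R X Y) (g : WebTm R Y Z) :
      WebRel a (f ≫ᵗ (r •ᵗ g)) (r •ᵗ (f ≫ᵗ g))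
  | add_tensor {X Y X' Y'} (f g : WebTm R X Y) (h : WebTm R X' Y') :
      WebRel a ((f +ᵗ g) ⊗ᵗ h) ((f ⊗ᵗ h) +ᵗ (g ⊗ᵗ h))
  | tensor_add {X Y X' Y'} (f : WebTm R X Y) (g h : WebTm R X' Y') :
      WebRel a (f ⊗ᵗ (g +ᵗ h)) ((f ⊗ᵗ g) +ᵗ (f ⊗ᵗ h))
  | smul_tensor {X Y X' Y'} (r : R) (f : WebTm R X Y) (g : WebTm R X' Y') :
      WebRel a ((r •ᵗ f) ⊗ᵗ g) (r •ᵗ (f ⊗ᵗ g))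
  | tensor_smul {X Y X' Y'} (r : R) (f : WebTm R X Y) (g : WebTm R X' Y') :
      WebRel a (f ⊗ᵗ (r •ᵗ g)) (r •ᵗ (f ⊗ᵗ g))
  -- strands labelled `0` are erased
  | merge_zero_left (l : ℕ) : WebRel a (merge 0 l l (Nat.zero_add l)) (lunit (up l))
  | merge_zero_right (k : ℕ) : WebRel a (merge k 0 k (Nat.add_zero k)) (runit (up k))
  | split_zero_left (l : ℕ) : WebRel a (split 0 l l (Nat.zero_add l)) (lunitInv (up l))
  | split_zero_right (k : ℕ) : WebRel a (split k 0 k (Nat.add_zero k)) (runitInv (up k))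
  | capR_zero : WebRel a (capR 0) (lunit WebObj.one)
  | cupR_zero : WebRel a (cupR 0) (lunitInv WebObj.one)
  | capL_zero : WebRel a (capL 0) (lunit WebObj.one)
  | cupL_zero : WebRel a (cupL 0) (lunitInv WebObj.one)
  -- isotopy: caps and cups straighten
  | zigzag_up_right (k : ℕ) :
      WebRel a (runitInv (up k) ≫ᵗ (id (up k) ⊗ᵗ cupR k) ≫ᵗ assocInv _ _ _ ≫ᵗ
        (capR k ⊗ᵗ id (up k)) ≫ᵗ lunit (up k)) (id (up k))
  | zigzag_down_right (k : ℕ) :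
      WebRel a (lunitInv (dn k) ≫ᵗ (cupR k ⊗ᵗ id (dn k)) ≫ᵗ assoc _ _ _ ≫ᵗ
        (id (dn k) ⊗ᵗ capR k) ≫ᵗ runit (dn k)) (id (dn k))
  | zigzag_up_left (k : ℕ) :
      WebRel a (lunitInv (up k) ≫ᵗ (cupL k ⊗ᵗ id (up k)) ≫ᵗ assoc _ _ _ ≫ᵗ
        (id (up k) ⊗ᵗ capL k) ≫ᵗ runit (up k)) (id (up k))
  | zigzag_down_left (k : ℕ) :
      WebRel a (runitInv (dn k) ≫ᵗ (id (dn k) ⊗ᵗ cupL k) ≫ᵗ assocInv _ _ _ ≫ᵗ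
        (capL k ⊗ᵗ id (dn k)) ≫ᵗ lunit (dn k)) (id (dn k))
  -- isotopy: turning a vertex upside down to the left or to the right gives the same web
  | rot_merge (k l m : ℕ) (h : k + l = m) :
      WebRel a (rotR (nestCup (cupR l) (cupR k)) (capR m) (merge k l m h))
        (rotL (nestCup (cupL k) (cupL l)) (capL m) (merge k l m h))
  | rot_split (k l m : ℕ) (h : k + l = m) :
      WebRel a (rotR (cupR m) (nestCap (capR k) (capR l)) (split k l m h))
        (rotL (cupL m) (nestCap (capL l) (capL k)) (split k l m h))
  -- upward webs
  | merge_assoc (k l r kl lr m : ℕ) (h₁ : k + l = kl) (h₂ : kl + r = m) (h₃ : l + r = lr)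
      (h₄ : k + lr = m) :
      WebRel a ((merge k l kl h₁ ⊗ᵗ id (up r)) ≫ᵗ merge kl r m h₂)
        (assoc _ _ _ ≫ᵗ (id (up k) ⊗ᵗ merge l r lr h₃) ≫ᵗ merge k lr m h₄)
  | split_assoc (k l r kl lr m : ℕ) (h₁ : k + l = kl) (h₂ : kl + r = m) (h₃ : l + r = lr)
      (h₄ : k + lr = m) :
      WebRel a (split kl r m h₂ ≫ᵗ (split k l kl h₁ ⊗ᵗ id (up r)) ≫ᵗ assoc _ _ _)
        (split k lr m h₄ ≫ᵗ (id (up k) ⊗ᵗ split l r lr h₃))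
  | digon (k l m : ℕ) (h : k + l = m) :
      WebRel a (split k l m h ≫ᵗ merge k l m h)
        (algebraMap (RatFunc ℚ) R (q⁻¹ ^ (k * l) * qBinom k m) •ᵗ id (up m))
  | square_switch (k l : ℕ) :
      WebRel a (ladderRL k l)
        (ladderLR k l +ᵗ
          algebraMap (RatFunc ℚ) R (q ^ (1 - k + l : ℤ) * qInt q (k - l)) •ᵗ id (up k ⊗ᵒ up l))
  | serre_left₁ (k l r : ℕ) :
      WebRel a
        ((onRight (up k) (rungL 1 (l + 1) r) ≫ᵗ onLeft (rungL 2 k l) (up r)) +ᵗ serreEE k l r)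
        (onLeft (rungL 1 k l) (up (r + 1)) ≫ᵗ onRight (up (k + 1)) (rungL 1 l r) ≫ᵗ
          onLeft (rungL 1 (k + 1) l) (up r))
  | serre_left₂ (k l r : ℕ) :
      WebRel a
        (serreEE' k l r +ᵗ (onRight (up k) (rungL 2 l r) ≫ᵗ onLeft (rungL 1 k (l + 1)) (up r)))
        (onRight (up k) (rungL 1 l (r + 1)) ≫ᵗ onLeft (rungL 1 k l) (up (r + 1)) ≫ᵗ
          onRight (up (k + 1)) (rungL 1 l r))
  | serre_right₁ (k l r : ℕ) :
      WebRel a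
        (serreFF k l r +ᵗ (onLeft (rungR 2 k l) (up r) ≫ᵗ onRight (up k) (rungR 1 (l + 1) r)))
        (onLeft (rungR 1 (k + 1) l) (up r) ≫ᵗ onRight (up (k + 1)) (rungR 1 l r) ≫ᵗ
          onLeft (rungR 1 k l) (up (r + 1)))
  | serre_right₂ (k l r : ℕ) :
      WebRel a
        ((onLeft (rungR 1 k (l + 1)) (up r) ≫ᵗ onRight (up k) (rungR 2 l r)) +ᵗ serreFF' k l r)
        (onRight (up (k + 1)) (rungR 1 l r) ≫ᵗ onLeft (rungR 1 k l) (up (r + 1)) ≫ᵗ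
          onRight (up k) (rungR 1 l (r + 1)))
  -- circles
  | circle_cw (k : ℕ) :
      WebRel a (cupL k ≫ᵗ capR k) (circleVal a k •ᵗ id WebObj.one)
  | circle_ccw (k : ℕ) :
      WebRel a (cupR k ≫ᵗ capL k) (circleVal a k •ᵗ id WebObj.one)
  -- sideway digons
  | side_digon_right : WebRel a sideDigonR (aInt a 1 •ᵗ id (up 1))
  | side_digon_left : WebRel a sideDigonL (aInt a 1 •ᵗ id (up 1))
  -- mixed square and its mirror image
  | square : WebRel a (sideR ≫ᵗ sideL)
      (id (up 1 ⊗ᵒ dn 1) +ᵗ aInt a 2 •ᵗ (capR 1 ≫ᵗ cupL 1))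
  | square_mirror : WebRel a (sideL ≫ᵗ sideR)
      (id (dn 1 ⊗ᵒ up 1) +ᵗ aInt a 2 •ᵗ (capL 1 ≫ᵗ cupR 1))

/-- The setoid of web relations. -/
def webSetoid (a : Rˣ) (X Y : WebObj) : Setoid (WebTm R X Y) :=
  ⟨WebRel a, WebRel.refl, WebRel.symm, WebRel.trans⟩

/-- The category of webs with parameters `q` and `a` and coefficients in `R`, that is, the base
change to `R` of the universal web category over `ℤ[q^±1, a^±1][(q - q⁻¹)⁻¹]`. -/
structure InfWeb (a : Rˣ) : Type where
  /-- the underlying word -/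
  word : WebObj

/-- Webs modulo relations. -/
def WebHom (a : Rˣ) (X Y : WebObj) : Type u := Quotient (webSetoid a X Y)

namespace WebHom

variable {a : Rˣ}

/-- The class of a formal web expression. -/
def mk (a : Rˣ) {X Y : WebObj} (f : WebTm R X Y) : WebHom a X Y := Quotient.mk (webSetoid a X Y) f

theorem sound {X Y : WebObj} {f g : WebTm R X Y} (h : WebRel a f g) : mk a f = mk a g :=
  Quotient.sound h

/-- Composition of webs. -/
def comp {X Y Z : WebObj} (f : WebHom a X Y) (g : WebHom a Y Z) : WebHom a X Z :=
  Quotient.liftOn₂ f g (fun f g => mk a (f ≫ᵗ g))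
    fun _ _ _ _ h h' => sound (WebRel.comp_congr h h')

/-- Juxtaposition of webs. -/
def tensor {X Y X' Y' : WebObj} (f : WebHom a X Y) (g : WebHom a X' Y') :
    WebHom a (X ⊗ᵒ X') (Y ⊗ᵒ Y') :=
  Quotient.liftOn₂ f g (fun f g => mk a (f ⊗ᵗ g))
    fun _ _ _ _ h h' => sound (WebRel.tensor_congr h h')

instance (X Y : WebObj) : Zero (WebHom a X Y) := ⟨mk a (WebTm.zero X Y)⟩

instance (X Y : WebObj) : Add (WebHom a X Y) :=
  ⟨fun f g => Quotient.liftOn₂ f g (fun f g => mk a (f +ᵗ g))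
    fun _ _ _ _ h h' => sound (WebRel.add_congr h h')⟩

instance (X Y : WebObj) : SMul R (WebHom a X Y) :=
  ⟨fun r f => Quotient.liftOn f (fun f => mk a (r •ᵗ f))
    fun _ _ h => sound (WebRel.smul_congr r h)⟩

instance (X Y : WebObj) : Neg (WebHom a X Y) := ⟨fun f => (-1 : R) • f⟩

theorem mk_add {X Y : WebObj} (f g : WebTm R X Y) : mk a (f +ᵗ g) = mk a f + mk a g := rfl

theorem mk_smul {X Y : WebObj} (r : R) (f : WebTm R X Y) : mk a (r •ᵗ f) = r • mk a f := rfl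

theorem ind {X Y : WebObj} {p : WebHom a X Y → Prop} (h : ∀ f, p (mk a f)) (f : WebHom a X Y) :
    p f := Quotient.ind h f

theorem zero_smul' {X Y : WebObj} (f : WebHom a X Y) : (0 : R) • f = 0 := by
  induction f using ind with | h f => exact sound (WebRel.zero_smul f)

theorem one_smul' {X Y : WebObj} (f : WebHom a X Y) : (1 : R) • f = f := by
  induction f using ind with | h f => exact sound (WebRel.one_smul f)

theorem add_smul' {X Y : WebObj} (r s : R) (f : WebHom a X Y) :
    (r + s) • f = r • f + s • f := by
  induction f using ind with | h f => exact sound (WebRel.add_smul r s f)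

theorem mul_smul' {X Y : WebObj} (r s : R) (f : WebHom a X Y) :
    (r * s) • f = r • s • f := by
  induction f using ind with | h f => exact sound (WebRel.mul_smul r s f)

theorem add_comm' {X Y : WebObj} (f g : WebHom a X Y) : f + g = g + f := by
  induction f using ind with | h f =>
  induction g using ind with | h g => exact sound (WebRel.add_comm f g)

theorem zero_add' {X Y : WebObj} (f : WebHom a X Y) : 0 + f = f := by
  induction f using ind with | h f => exact sound (WebRel.zero_add f)

instance (X Y : WebObj) : AddCommGroup (WebHom a X Y) where
  add_assoc f g h := by
    induction f using ind with | h f =>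
    induction g using ind with | h g =>
    induction h using ind with | h h => exact sound (WebRel.add_assoc f g h)
  zero_add := zero_add'
  add_zero f := by rw [add_comm', zero_add']
  add_comm := add_comm'
  neg_add_cancel f := by
    change (-1 : R) • f + f = 0
    nth_rewrite 2 [← one_smul' f]
    rw [← add_smul', neg_add_cancel, zero_smul']
  nsmul := nsmulRec
  zsmul := zsmulRec

instance (X Y : WebObj) : Module R (WebHom a X Y) where
  one_smul := one_smul'
  mul_smul := mul_smul'
  smul_zero r := by
    rw [← zero_smul' (0 : WebHom a X Y), ← mul_smul', mul_zero]
  smul_add r f g := by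
    induction f using ind with | h f =>
    induction g using ind with | h g => exact sound (WebRel.smul_add r f g)
  add_smul := add_smul'
  zero_smul := zero_smul'

end WebHom

open WebHom

instance (a : Rˣ) : Category.{u} (InfWeb a) where
  Hom X Y := WebHom a X.word Y.word
  id X := WebHom.mk a (WebTm.id X.word)
  comp f g := WebHom.comp f g
  id_comp f := by
    induction f using ind with | h f => exact sound (WebRel.id_comp f)
  comp_id f := by
    induction f using ind with | h f => exact sound (WebRel.comp_id f)
  assoc f g h := by
    induction f using ind with | h f =>
    induction g using ind with | h g =>
    induction h using ind with | h h => exact sound (WebRel.comp_assoc f g h)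

instance (a : Rˣ) : Preadditive (InfWeb a) where
  homGroup X Y := inferInstanceAs (AddCommGroup (WebHom a X.word Y.word))
  add_comp _ _ _ f g h := by
    induction f using ind with | h f =>
    induction g using ind with | h g =>
    induction h using ind with | h h => exact sound (WebRel.add_comp f g h)
  comp_add _ _ _ f g h := by
    induction f using ind with | h f =>
    induction g using ind with | h g =>
    induction h using ind with | h h => exact sound (WebRel.comp_add f g h)

instance (a : Rˣ) : Linear R (InfWeb a) where
  homModule X Y := inferInstanceAs (Module R (WebHom a X.word Y.word))
  smul_comp _ _ _ r f g := by
    induction f using ind with | h f =>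
    induction g using ind with | h g => exact sound (WebRel.smul_comp r f g)
  comp_smul _ _ _ f r g := by
    induction f using ind with | h f =>
    induction g using ind with | h g => exact sound (WebRel.comp_smul r f g)

instance (a : Rˣ) : MonoidalCategoryStruct (InfWeb a) where
  tensorObj X Y := ⟨X.word ⊗ᵒ Y.word⟩
  tensorUnit := ⟨WebObj.one⟩
  tensorHom f g := WebHom.tensor f g
  whiskerLeft X _ _ f := WebHom.tensor (WebHom.mk a (WebTm.id X.word)) f
  whiskerRight f Y := WebHom.tensor f (WebHom.mk a (WebTm.id Y.word))
  associator X Y Z :=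
    { hom := WebHom.mk a (WebTm.assoc X.word Y.word Z.word)
      inv := WebHom.mk a (WebTm.assocInv X.word Y.word Z.word)
      hom_inv_id := sound (WebRel.assoc_hom_inv _ _ _)
      inv_hom_id := sound (WebRel.assoc_inv_hom _ _ _) }
  leftUnitor X :=
    { hom := WebHom.mk a (WebTm.lunit X.word)
      inv := WebHom.mk a (WebTm.lunitInv X.word)
      hom_inv_id := sound (WebRel.lunit_hom_inv _)
      inv_hom_id := sound (WebRel.lunit_inv_hom _) }
  rightUnitor X :=
    { hom := WebHom.mk a (WebTm.runit X.word)
      inv := WebHom.mk a (WebTm.runitInv X.word)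
      hom_inv_id := sound (WebRel.runit_hom_inv _)
      inv_hom_id := sound (WebRel.runit_inv_hom _) }

instance (a : Rˣ) : MonoidalCategory (InfWeb a) :=
  MonoidalCategory.ofTensorHom
    (id_tensorHom_id := fun _ _ => sound (WebRel.tensor_id _ _))
    (id_tensorHom := fun _ _ _ _ => rfl)
    (tensorHom_id := fun _ _ => rfl)
    (tensorHom_comp_tensorHom := fun f f' g g' => by
      induction f using ind with | h f =>
      induction f' using ind with | h f' =>
      induction g using ind with | h g =>
      induction g' using ind with | h g' => exact sound (WebRel.tensor_comp f f' g g'))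
    (associator_naturality := fun f f' f'' => by
      induction f using ind with | h f =>
      induction f' using ind with | h f' =>
      induction f'' using ind with | h f'' => exact sound (WebRel.assoc_nat f f' f''))
    (leftUnitor_naturality := fun f => by
      induction f using ind with | h f => exact sound (WebRel.lunit_nat f))
    (rightUnitor_naturality := fun f => by
      induction f using ind with | h f => exact sound (WebRel.runit_nat f))
    (pentagon := fun _ _ _ _ => sound (WebRel.pentagon _ _ _ _))
    (triangle := fun _ _ => sound (WebRel.triangle _ _))

/-! ### The doubled Schur algebra `S₂(1, 1, 0)` -/

/-- The object `(k↑, k↓)`. -/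
def upDown (a : Rˣ) (k : ℕ) : InfWeb a := ⟨up k ⊗ᵒ dn k⟩

/-- The cap `(k↑, k↓) → ∅`. -/
def webCap (a : Rˣ) (k : ℕ) : upDown a k ⟶ 𝟙_ (InfWeb a) := WebHom.mk a (WebTm.capR k)

/-- The cup `∅ → (k↑, k↓)`. -/
def webCup (a : Rˣ) (k : ℕ) : 𝟙_ (InfWeb a) ⟶ upDown a k := WebHom.mk a (WebTm.cupL k)

/-- The algebra of endomorphisms of the formal direct sum of all the objects `(k↑, k↓)`, `k ≥ 0`:
matrices with finitely many non-zero entries, the entry `(k, l)` being a morphism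
`(k↑, k↓) → (l↑, l↓)`. -/
abbrev Schur (a : Rˣ) : Type u := ⨁ p : ℕ × ℕ, (upDown a p.1 ⟶ upDown a p.2)

namespace Schur

variable (a : Rˣ)

/-- The matrix with a single entry, a morphism `(k↑, k↓) → (l↑, l↓)`. -/
def entry (k l : ℕ) : (upDown a k ⟶ upDown a l) →ₗ[R] Schur a :=
  DirectSum.lof R (ℕ × ℕ) (fun p : ℕ × ℕ => (upDown a p.1 ⟶ upDown a p.2)) (k, l)

/-- The product of two entries: `g * f = g ∘ f` if source and target match, and `0` otherwise. -/
def entryMul (p p' : ℕ × ℕ) :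
    (upDown a p.1 ⟶ upDown a p.2) →ₗ[R] (upDown a p'.1 ⟶ upDown a p'.2) →ₗ[R] Schur a :=
  if h : p'.2 = p.1 then
    LinearMap.mk₂ R
      (fun g f => entry a p'.1 p.2 (f ≫ eqToHom (congrArg (upDown a) h) ≫ g))
      (fun g g' f => by simp) (fun r g f => by simp)
      (fun g f f' => by simp) (fun r g f => by simp)
  else 0

/-- Matrix multiplication, as a bilinear map. -/
def mulLin : Schur a →ₗ[R] Schur a →ₗ[R] Schur a :=
  DirectSum.toModule R (ℕ × ℕ) (Schur a →ₗ[R] Schur a) fun p =>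
    (DirectSum.toModule R (ℕ × ℕ) ((upDown a p.1 ⟶ upDown a p.2) →ₗ[R] Schur a)
      fun p' => (entryMul a p p').flip).flip

instance : Mul (Schur a) := ⟨fun g f => mulLin a g f⟩

theorem mul_def (g f : Schur a) : g * f = mulLin a g f := rfl

theorem entry_mul_entry (k l k' l' : ℕ) (g : upDown a k ⟶ upDown a l)
    (f : upDown a k' ⟶ upDown a l') :
    entry a k l g * entry a k' l' f = entryMul a (k, l) (k', l') g f := by
  rw [mul_def, mulLin, entry, entry, DirectSum.toModule_lof, LinearMap.flip_apply,
    DirectSum.toModule_lof, LinearMap.flip_apply]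

theorem entry_mul_entry_self (k l m : ℕ) (g : upDown a l ⟶ upDown a m)
    (f : upDown a k ⟶ upDown a l) :
    entry a l m g * entry a k l f = entry a k m (f ≫ g) := by
  rw [entry_mul_entry, entryMul, dif_pos rfl]
  simp

theorem entry_mul_entry_of_ne (k l l' m : ℕ) (h : l ≠ l') (g : upDown a l' ⟶ upDown a m)
    (f : upDown a k ⟶ upDown a l) :
    entry a l' m g * entry a k l f = 0 := by
  rw [entry_mul_entry, entryMul, dif_neg h]
  rfl

theorem induct {P : Schur a → Prop} (h0 : P 0)
    (h1 : ∀ (k l : ℕ) (f : upDown a k ⟶ upDown a l), P (entry a k l f))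
    (h2 : ∀ f g, P f → P g → P (f + g)) (f : Schur a) : P f :=
  DirectSum.induction_on f h0 (fun p f => h1 p.1 p.2 f) h2

theorem mul_add' (f g h : Schur a) : f * (g + h) = f * g + f * h := by simp [mul_def]

theorem add_mul' (f g h : Schur a) : (f + g) * h = f * h + g * h := by simp [mul_def]

theorem zero_mul' (f : Schur a) : 0 * f = 0 := by simp [mul_def]

theorem mul_zero' (f : Schur a) : f * 0 = 0 := by simp [mul_def]

theorem mul_assoc' (f g h : Schur a) : f * g * h = f * (g * h) := by
  induction f using induct with
  | h0 => simp only [zero_mul']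
  | h2 f f' hf hf' => simp only [add_mul', hf, hf']
  | h1 k l f =>
    induction g using induct with
    | h0 => simp only [zero_mul', mul_zero']
    | h2 g g' hg hg' => simp only [add_mul', mul_add', hg, hg']
    | h1 k' l' g =>
      induction h using induct with
      | h0 => simp only [mul_zero']
      | h2 h h' hh hh' => simp only [mul_add', hh, hh']
      | h1 k'' l'' h =>
        by_cases e : l' = k
        · subst e
          by_cases e' : l'' = k'
          · subst e'
            simp only [entry_mul_entry_self, Category.assoc]
          · simp only [entry_mul_entry_self, entry_mul_entry_of_ne a _ _ _ _ e', mul_zero']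
        · by_cases e' : l'' = k'
          · subst e'
            simp only [entry_mul_entry_self, entry_mul_entry_of_ne a _ _ _ _ e, zero_mul']
          · simp only [entry_mul_entry_of_ne a _ _ _ _ e, entry_mul_entry_of_ne a _ _ _ _ e',
              zero_mul', mul_zero']

instance : NonUnitalRing (Schur a) where
  left_distrib := mul_add' a
  right_distrib := add_mul' a
  zero_mul := zero_mul' a
  mul_zero := mul_zero' a
  mul_assoc := mul_assoc' a

instance : IsScalarTower R (Schur a) (Schur a) :=
  ⟨fun r f g => by simp [mul_def]⟩

instance : SMulCommClass R (Schur a) (Schur a) :=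
  ⟨fun r f g => by simp [mul_def]⟩

/-- The web `f_k`: a cap labelled `k` followed by a cup labelled `k`. -/
def capCup (k : ℕ) : Schur a := entry a k k (webCap a k ≫ webCup a k)

/-- `e_k = f_k / μ_k` (meaningful if `μ_k` is invertible). -/
def idem (k : ℕ) : Schur a := Ring.inverse (circleVal a k) • capCup a k

/-- The identity of the object without strands, `(0↑, 0↓)`: the empty web. -/
def emptyWeb : Schur a := entry a 0 0 (𝟙 (upDown a 0))

end Schur

end Category

/-! ### The specialisation at a rational number -/

/-- The parameter `a = q ν_x δ_x`, where `ν_x ^ 2 = δ_x⁻¹`; its inverse is `q⁻¹ ν_x`. -/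
def xParam {R : Type u} [CommRing R] [Algebra (RatFunc ℚ) R] (x : ℚ) (ν : R)
    (hν : ν ^ 2 * algebraMap (RatFunc ℚ) R (qDelta x) = 1) : Rˣ where
  val := algebraMap (RatFunc ℚ) R q * ν * algebraMap (RatFunc ℚ) R (qDelta x)
  inv := algebraMap (RatFunc ℚ) R q⁻¹ * ν
  val_inv := by
    have hq : algebraMap (RatFunc ℚ) R q * algebraMap (RatFunc ℚ) R q⁻¹ = 1 := by
      rw [← map_mul, mul_inv_cancel₀ (by simpa [q] using RatFunc.X_ne_zero), map_one]
    linear_combination ν ^ 2 * algebraMap (RatFunc ℚ) R (qDelta x) * hq + hν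
  inv_val := by
    have hq : algebraMap (RatFunc ℚ) R q * algebraMap (RatFunc ℚ) R q⁻¹ = 1 := by
      rw [← map_mul, mul_inv_cancel₀ (by simpa [q] using RatFunc.X_ne_zero), map_one]
    linear_combination ν ^ 2 * algebraMap (RatFunc ℚ) R (qDelta x) * hq + hν

/-- The category of webs with parameter `x`. -/
abbrev XWeb {R : Type u} [CommRing R] [Algebra (RatFunc ℚ) R] (x : ℚ) (ν : R)
    (hν : ν ^ 2 * algebraMap (RatFunc ℚ) R (qDelta x) = 1) : Type :=
  InfWeb (xParam x ν hν)

/-- The `x`-analogue `S₂ˣ(1, 1, 0)` of the doubled Schur algebra. -/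
abbrev XSchur {R : Type u} [CommRing R] [Algebra (RatFunc ℚ) R] (x : ℚ) (ν : R)
    (hν : ν ^ 2 * algebraMap (RatFunc ℚ) R (qDelta x) = 1) : Type u :=
  Schur (xParam x ν hν)

end QWeb

end

/-!
Let `x_k` be the web `(k↑, k↓) → ((k+1)↑, (k+1)↓)` that merges the strands of an inner cup into
the outer strands, and `y_k` the web that splits off an inner cap.  The relations of the web
category give `y_k x_k = x_{k-1} y_{k-1} + c_{2k}`, and hence
`y_{j+m} x_{j+m} ⋯ x_j = x_{j+m-1} ⋯ x_j (x_{j-1} y_{j-1}) + [m+1] c_{2j+m} x_{j+m-1} ⋯ x_j`,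
where `[n]` is the balanced quantum integer.

In a finite quotient the identity of `(k↑, k↓)` annihilates a finite set of generators for all
large `k`, and so it vanishes.  If all `c_r` are units, then by induction on `j` it vanishes for
every `j`: the correction term factors through `j - 1`, so the formula lets one remove the factors
`x_{j+m}, …, x_j` one at a time.

The coefficients `c_r` are units because `q² δ_x = (q² - 1) {x} + 1` equals `q^{2r}` only if
`{x} = {r}`, which at `q = 1` means `x = r`.
-/

namespace QWeb

section Mates

variable {C : Type*} [Category* C] [MonoidalCategory C] {X Y Z : C} (X' Y' Z' : C)
  [ExactPairing X X'] [ExactPairing Y Y'] [ExactPairing Z Z']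

/-- The mate of `f : X ⟶ Y`, that is, the web `f` rotated by a half turn.  Unlike in
`rightAdjointMate`, the dual objects are explicit arguments: the object `U ⊗ D` occurs below both
with its dual as a tensor product and as the dual of itself. -/
def mate (f : X ⟶ Y) : Y' ⟶ X' :=
  letI : HasRightDual X := ⟨X'⟩
  letI : HasRightDual Y := ⟨Y'⟩
  rightAdjointMate f

variable {X' Y' Z'}

theorem mate_def (f : X ⟶ Y) :
    mate X' Y' f = (ρ_ Y').inv ≫ Y' ◁ η_ X X' ≫ Y' ◁ f ▷ X' ≫ (α_ Y' Y X').inv ≫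
      ε_ Y Y' ▷ X' ≫ (λ_ X').hom := rfl

theorem mate_evaluation (f : X ⟶ Y) : mate X' Y' f ▷ X ≫ ε_ X X' = Y' ◁ f ≫ ε_ Y Y' :=
  letI : HasRightDual X := ⟨X'⟩
  letI : HasRightDual Y := ⟨Y'⟩
  rightAdjointMate_comp_evaluation f

theorem mate_eq_of_evaluation {f : X ⟶ Y} {g : Y' ⟶ X'}
    (h : g ▷ X ≫ ε_ X X' = Y' ◁ f ≫ ε_ Y Y') : mate X' Y' f = g := by
  calc
    mate X' Y' f
      = (ρ_ Y').inv ≫ Y' ◁ η_ X X' ≫ (α_ _ _ _).inv ≫ (g ▷ X ≫ ε_ X X') ▷ X' ≫ (λ_ X').hom := by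
        rw [h, mate_def]; simp
    _ = (ρ_ Y').inv ≫ (g ▷ 𝟙_ C ≫ X' ◁ η_ X X') ≫ (α_ _ _ _).inv ≫ ε_ X X' ▷ X' ≫
        (λ_ X').hom := by
      rw [← whisker_exchange]; simp
    _ = g ≫ (ρ_ X').inv ≫ (X' ◁ η_ X X' ≫ (α_ _ _ _).inv ≫ ε_ X X' ▷ X') ≫ (λ_ X').hom := by simp
    _ = g := by simp

theorem mate_id : mate X' X' (𝟙 X) = 𝟙 X' :=
  letI : HasRightDual X := ⟨X'⟩
  rightAdjointMate_id

theorem mate_comp (f : X ⟶ Y) (g : Y ⟶ Z) :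
    mate X' Z' (f ≫ g) = mate Y' Z' g ≫ mate X' Y' f :=
  letI : HasRightDual X := ⟨X'⟩
  letI : HasRightDual Y := ⟨Y'⟩
  letI : HasRightDual Z := ⟨Z'⟩
  comp_rightAdjointMate

theorem mate_whiskerLeft (W : C) {W' : C} [ExactPairing W W'] (f : X ⟶ Y) :
    mate (X' ⊗ W') (Y' ⊗ W') (W ◁ f) = mate X' Y' f ▷ W' := by
  apply mate_eq_of_evaluation
  simp only [ExactPairing.tensor_evaluation]
  calc
    _ = 𝟙 _ ⊗≫ (mate X' Y' f ▷ ((W' ⊗ W) ⊗ X) ≫ X' ◁ (ε_ W W' ▷ X)) ⊗≫ ε_ X X' := by monoidal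
    _ = 𝟙 _ ⊗≫ Y' ◁ (ε_ W W' ▷ X) ⊗≫ (mate X' Y' f ▷ X ≫ ε_ X X') := by
      rw [← whisker_exchange]; monoidal
    _ = 𝟙 _ ⊗≫ Y' ◁ (ε_ W W' ▷ X ≫ 𝟙_ C ◁ f) ⊗≫ ε_ Y Y' := by
      rw [mate_evaluation]; monoidal
    _ = _ := by rw [← whisker_exchange]; monoidal

theorem mate_whiskerRight (W : C) {W' : C} [ExactPairing W W'] (f : X ⟶ Y) :
    mate (W' ⊗ X') (W' ⊗ Y') (f ▷ W) = W' ◁ mate X' Y' f := by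
  apply mate_eq_of_evaluation
  simp only [ExactPairing.tensor_evaluation]
  calc
    _ = 𝟙 _ ⊗≫ W' ◁ ((mate X' Y' f ▷ X ≫ ε_ X X') ▷ W) ⊗≫ ε_ W W' := by monoidal
    _ = _ := by rw [mate_evaluation]; monoidal

theorem mate_associator_hom :
    mate (Z' ⊗ (Y' ⊗ X')) ((Z' ⊗ Y') ⊗ X') (α_ X Y Z).hom = (α_ Z' Y' X').hom := by
  apply mate_eq_of_evaluation
  simp only [ExactPairing.tensor_evaluation]
  monoidal

theorem mate_associator_inv :
    mate ((Z' ⊗ Y') ⊗ X') (Z' ⊗ (Y' ⊗ X')) (α_ X Y Z).inv = (α_ Z' Y' X').inv := by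
  apply mate_eq_of_evaluation
  simp only [ExactPairing.tensor_evaluation]
  monoidal

theorem evaluation_tensorUnit : ε_ (𝟙_ C) (𝟙_ C) = (ρ_ (𝟙_ C)).hom := rfl

theorem mate_rightUnitor_inv : mate X' (𝟙_ C ⊗ X') (ρ_ X).inv = (λ_ X').hom := by
  apply mate_eq_of_evaluation
  simp only [ExactPairing.tensor_evaluation, evaluation_tensorUnit]
  monoidal

theorem mate_rightUnitor_hom : mate (𝟙_ C ⊗ X') X' (ρ_ X).hom = (λ_ X').inv := by
  apply mate_eq_of_evaluation
  simp only [ExactPairing.tensor_evaluation, evaluation_tensorUnit]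
  monoidal

theorem mate_add [Preadditive C] [MonoidalPreadditive C] (f g : X ⟶ Y) :
    mate X' Y' (f + g) = mate X' Y' f + mate X' Y' g := by
  simp [mate_def]

theorem mate_smul {R : Type*} [CommRing R] [Preadditive C] [Linear R C] [MonoidalPreadditive C]
    [MonoidalLinear R C] (r : R) (f : X ⟶ Y) : mate X' Y' (r • f) = r • mate X' Y' f := by
  simp [mate_def]

variable (U D : C) [ExactPairing U D] [ExactPairing D U]

theorem mate_coevaluation : mate (𝟙_ C) (U ⊗ D) (η_ U D) = ε_ D U := by
  apply mate_eq_of_evaluation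
  simp only [ExactPairing.tensor_evaluation, evaluation_tensorUnit]
  calc
    _ = (ρ_ (U ⊗ D)).hom ≫ ε_ D U := by monoidal
    _ = 𝟙 _ ⊗≫ U ◁ (D ◁ η_ U D ⊗≫ ε_ U D ▷ D) ⊗≫ ε_ D U := by
      rw [ExactPairing.coevaluation_evaluation'']; monoidal
    _ = _ := by monoidal

theorem mate_evaluation_self : mate (U ⊗ D) (𝟙_ C) (ε_ D U) = η_ U D := by
  apply mate_eq_of_evaluation
  simp only [ExactPairing.tensor_evaluation, evaluation_tensorUnit]
  calc
    _ = 𝟙 _ ⊗≫ (η_ U D ▷ (U ⊗ D) ≫ (U ⊗ D) ◁ 𝟙 (U ⊗ D)) ⊗≫ U ◁ (ε_ U D ▷ D) ⊗≫ ε_ D U := by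
      monoidal
    _ = 𝟙 _ ⊗≫ (η_ U D ▷ U ⊗≫ U ◁ ε_ U D) ▷ D ⊗≫ ε_ D U := by monoidal
    _ = _ := by rw [ExactPairing.evaluation_coevaluation'']; monoidal

end Mates

section Bridges

variable {C : Type*} [Category* C] [MonoidalCategory C] {U D : C}

section Definitions

variable (U D)

/-- A cup inserted between the strands `X` and `Y`. -/
def insertCup [ExactPairing U D] (X Y : C) : X ⊗ Y ⟶ (X ⊗ U) ⊗ (D ⊗ Y) :=
  𝟙 _ ⊗≫ X ◁ η_ U D ▷ Y ⊗≫ 𝟙 _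

/-- A cap inserted between the strands `X` and `Y`. -/
def insertCap [ExactPairing D U] (X Y : C) : (X ⊗ U) ⊗ (D ⊗ Y) ⟶ X ⊗ Y :=
  𝟙 _ ⊗≫ X ◁ ε_ D U ▷ Y ⊗≫ 𝟙 _

/-- The web obtained from `f` and `g` by joining their inner strands by a cup and a cap. -/
def bridge [ExactPairing U D] [ExactPairing D U] {X Y V W : C} (f : X ⊗ U ⟶ V ⊗ U)
    (g : D ⊗ Y ⟶ D ⊗ W) : X ⊗ Y ⟶ V ⊗ W :=
  insertCup U D X Y ≫ (f ⊗ₘ g) ≫ insertCap U D V W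

/-- The cup between `X` and `Y` whose ends are merged with `X` and `Y`. -/
def raise [ExactPairing U D] {X Y V W : C} (f : X ⊗ U ⟶ V) (g : D ⊗ Y ⟶ W) : X ⊗ Y ⟶ V ⊗ W :=
  insertCup U D X Y ≫ (f ⊗ₘ g)

/-- The cap whose ends are split off from `V` and `W`. -/
def lower [ExactPairing D U] {X Y V W : C} (f : V ⟶ X ⊗ U) (g : W ⟶ D ⊗ Y) : V ⊗ W ⟶ X ⊗ Y :=
  (f ⊗ₘ g) ≫ insertCap U D X Y

end Definitions

/-- The partial closure on the right of an endomorphism of `U ⊗ U`. -/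
def closeRight [ExactPairing U D] [ExactPairing D U] (d : U ⊗ U ⟶ U ⊗ U) : U ⟶ U :=
  (ρ_ U).inv ≫ U ◁ η_ U D ≫ (α_ _ _ _).inv ≫ d ▷ D ≫ (α_ _ _ _).hom ≫ U ◁ ε_ D U ≫ (ρ_ U).hom

/-- The partial closure on the left of an endomorphism of `D ⊗ D`. -/
def closeLeft [ExactPairing U D] [ExactPairing D U] (e : D ⊗ D ⟶ D ⊗ D) : D ⟶ D :=
  (λ_ D).inv ≫ η_ U D ▷ D ≫ (α_ _ _ _).hom ≫ U ◁ e ≫ (α_ _ _ _).inv ≫ ε_ D U ▷ D ≫ (λ_ D).hom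

theorem tensorHom_insertCup [ExactPairing U D] {X Y V W : C} (f : X ⟶ V) (g : Y ⟶ W) :
    (f ⊗ₘ g) ≫ insertCup U D V W = insertCup U D X Y ≫ (f ▷ U ⊗ₘ D ◁ g) := by
  simp only [insertCup, MonoidalCategory.tensorHom_def]
  calc
    _ = f ▷ Y ⊗≫ V ◁ (𝟙_ C ◁ g ≫ η_ U D ▷ W) ⊗≫ 𝟙 _ := by monoidal
    _ = 𝟙 _ ⊗≫ (f ▷ (𝟙_ C) ≫ V ◁ η_ U D) ▷ Y ⊗≫ ((V ⊗ U) ⊗ D) ◁ g ⊗≫ 𝟙 _ := by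
      rw [whisker_exchange]; monoidal
    _ = _ := by rw [← whisker_exchange]; monoidal

theorem insertCap_tensorHom [ExactPairing D U] {X Y V W : C} (f : X ⟶ V) (g : Y ⟶ W) :
    insertCap U D X Y ≫ (f ⊗ₘ g) = (f ▷ U ⊗ₘ D ◁ g) ≫ insertCap U D V W := by
  simp only [insertCap, MonoidalCategory.tensorHom_def]
  calc
    _ = 𝟙 _ ⊗≫ (X ◁ ε_ D U ≫ f ▷ (𝟙_ C)) ▷ Y ⊗≫ V ◁ g := by monoidal
    _ = 𝟙 _ ⊗≫ f ▷ ((U ⊗ D) ⊗ Y) ⊗≫ V ◁ (ε_ D U ▷ Y ≫ 𝟙_ C ◁ g) ⊗≫ 𝟙 _ := by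
      rw [whisker_exchange]; monoidal
    _ = _ := by rw [← whisker_exchange]; monoidal

variable [ExactPairing U D] [ExactPairing D U]

theorem bridge_comp {X Y V W X₁ Y₁ V₁ W₁ : C} (f : X₁ ⊗ U ⟶ V₁ ⊗ U) (g : D ⊗ Y₁ ⟶ D ⊗ W₁)
    (s : X ⟶ X₁) (t : Y ⟶ Y₁) (s' : V₁ ⟶ V) (t' : W₁ ⟶ W) :
    bridge U D (s ▷ U ≫ f ≫ s' ▷ U) (D ◁ t ≫ g ≫ D ◁ t') =
      (s ⊗ₘ t) ≫ bridge U D f g ≫ (s' ⊗ₘ t') := by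
  simp only [bridge, Category.assoc, insertCap_tensorHom]
  rw [← Category.assoc (s ⊗ₘ t), tensorHom_insertCup]
  simp only [Category.assoc, tensorHom_comp_tensorHom_assoc]

theorem bridge_whiskerLeft (J : C) {X Y V W : C} (f : X ⊗ U ⟶ V ⊗ U) (g : D ⊗ Y ⟶ D ⊗ W) :
    bridge U D ((α_ J X U).hom ≫ J ◁ f ≫ (α_ J V U).inv) g =
      (α_ J X Y).hom ≫ J ◁ bridge U D f g ≫ (α_ J V W).inv := by
  simp only [bridge, insertCup, insertCap, MonoidalCategory.tensorHom_def]
  monoidal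

theorem bridge_whiskerRight (J : C) {X Y V W : C} (f : X ⊗ U ⟶ V ⊗ U) (g : D ⊗ Y ⟶ D ⊗ W) :
    bridge U D f ((α_ D Y J).inv ≫ g ▷ J ≫ (α_ D W J).hom) =
      (α_ X Y J).inv ≫ bridge U D f g ▷ J ≫ (α_ V W J).hom := by
  simp only [bridge, insertCup, insertCap, MonoidalCategory.tensorHom_def']
  monoidal

theorem bridge_id_right (Y : C) (d : U ⊗ U ⟶ U ⊗ U) :
    bridge U D d (𝟙 (D ⊗ Y)) = closeRight (D := D) d ▷ Y := by
  simp only [bridge, insertCup, insertCap, MonoidalCategory.tensorHom_def, closeRight]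
  monoidal

theorem bridge_id_left (X : C) (e : D ⊗ D ⟶ D ⊗ D) :
    bridge U D (𝟙 (X ⊗ U)) e = X ◁ closeLeft (U := U) e := by
  simp only [bridge, insertCup, insertCap, MonoidalCategory.tensorHom_def, closeLeft]
  monoidal

theorem mate_closeRight (d : U ⊗ U ⟶ U ⊗ U) :
    mate D D (closeRight (D := D) d) = closeLeft (U := U) (mate (D ⊗ D) (D ⊗ D) d) := by
  rw [closeRight, mate_comp (Y' := 𝟙_ C ⊗ D), mate_comp (Y' := (U ⊗ D) ⊗ D),
    mate_comp (Y' := U ⊗ (D ⊗ D)), mate_comp (Y' := U ⊗ (D ⊗ D)), mate_comp (Y' := (U ⊗ D) ⊗ D),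
    mate_comp (Y' := 𝟙_ C ⊗ D), mate_rightUnitor_inv, mate_rightUnitor_hom, mate_whiskerLeft,
    mate_whiskerLeft, mate_coevaluation, mate_evaluation_self, mate_associator_hom,
    mate_associator_inv, mate_whiskerRight, closeLeft]
  simp only [Category.assoc]

theorem raise_comp_lower {X V X' V' : C} [ExactPairing X X'] [ExactPairing V V']
    (m : X ⊗ U ⟶ V) (s : V ⟶ X ⊗ U) :
    raise U D m (mate V' (D ⊗ X') s) ≫ lower U D s (mate (D ⊗ X') V' m) =
      bridge U D (m ≫ s) (mate (D ⊗ X') (D ⊗ X') (m ≫ s)) := by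
  simp [raise, lower, bridge, mate_comp (Y' := V')]

variable {R : Type*} [CommRing R] [Preadditive C] [Linear R C] [MonoidalPreadditive C]
  [MonoidalLinear R C]

theorem bridge_id_id {c : R} (h : η_ U D ≫ ε_ D U = c • 𝟙 (𝟙_ C)) (X Y : C) :
    bridge U D (𝟙 (X ⊗ U)) (𝟙 (D ⊗ Y)) = c • 𝟙 (X ⊗ Y) := by
  calc
    _ = 𝟙 _ ⊗≫ X ◁ (η_ U D ≫ ε_ D U) ▷ Y ⊗≫ 𝟙 _ := by
      simp only [bridge, insertCup, insertCap, MonoidalCategory.tensorHom_def]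
      monoidal
    _ = _ := by rw [h]; simp [monoidalComp]

theorem bridge_sub_smul_id {X Y : C} (f : X ⊗ U ⟶ X ⊗ U) (g : D ⊗ Y ⟶ D ⊗ Y) (r : R) :
    bridge U D (f - r • 𝟙 _) (g - r • 𝟙 _) =
      bridge U D f g - r • bridge U D f (𝟙 _) - r • bridge U D (𝟙 _) g +
        r ^ 2 • bridge U D (𝟙 (X ⊗ U)) (𝟙 (D ⊗ Y)) := by
  simp [bridge, MonoidalCategory.tensorHom_def, sub_eq_add_neg, ← neg_smul]
  module

end Bridges

section Rotation

variable {C : Type*} [Category* C] [MonoidalCategory C] {U D : C}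

/-- An endomorphism of `U ⊗ U` rotated by a quarter turn, to the right. -/
def turnRight [ExactPairing D U] (d : U ⊗ U ⟶ U ⊗ U) : U ⊗ D ⟶ D ⊗ U :=
  (λ_ (U ⊗ D)).inv ≫ η_ D U ▷ (U ⊗ D) ≫ (α_ _ _ _).hom ≫
    D ◁ ((α_ _ _ _).inv ≫ d ▷ D ≫ (α_ _ _ _).hom ≫ U ◁ ε_ D U ≫ (ρ_ U).hom)

/-- An endomorphism of `U ⊗ U` rotated by a quarter turn, to the left. -/
def turnLeft [ExactPairing U D] (d : U ⊗ U ⟶ U ⊗ U) : D ⊗ U ⟶ U ⊗ D :=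
  (ρ_ (D ⊗ U)).inv ≫ (D ⊗ U) ◁ η_ U D ≫ (α_ _ _ _).inv ≫
    ((α_ _ _ _).hom ≫ D ◁ d ≫ (α_ _ _ _).inv ≫ ε_ U D ▷ U ≫ (λ_ U).hom) ▷ D

theorem turnRight_evaluation [ExactPairing D U] (d : U ⊗ U ⟶ U ⊗ U) :
    U ◁ turnRight (D := D) d ⊗≫ ε_ D U ▷ U =
      𝟙 _ ⊗≫ d ▷ D ⊗≫ U ◁ ε_ D U ⊗≫ 𝟙 _ := by
  rw [turnRight]
  calc
    _ = 𝟙 _ ⊗≫ U ◁ η_ D U ▷ (U ⊗ D) ⊗≫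
        ((U ⊗ D) ◁ (𝟙 (U ⊗ (U ⊗ D)) ⊗≫ d ▷ D ⊗≫ U ◁ ε_ D U ⊗≫ 𝟙 U) ≫ ε_ D U ▷ U) := by monoidal
    _ = 𝟙 _ ⊗≫ (U ◁ η_ D U ⊗≫ ε_ D U ▷ U) ▷ (U ⊗ D) ⊗≫ d ▷ D ⊗≫ U ◁ ε_ D U ⊗≫ 𝟙 _ := by
      rw [whisker_exchange]; monoidal
    _ = _ := by rw [ExactPairing.coevaluation_evaluation'']; monoidal

theorem coevaluation_mate [ExactPairing U D] (d : U ⊗ U ⟶ U ⊗ U) :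
    η_ U D ▷ D ⊗≫ U ◁ mate (D ⊗ D) (D ⊗ D) d =
      𝟙 _ ⊗≫ D ◁ η_ U D ⊗≫ turnLeft (D := D) d ▷ D ⊗≫ 𝟙 _ := by
  rw [turnLeft, mate_def, ExactPairing.tensor_coevaluation, ExactPairing.tensor_evaluation]
  calc
    _ = 𝟙 _ ⊗≫ (η_ U D ▷ D ≫ (U ⊗ D) ◁ (𝟙 D ⊗≫ D ◁ η_ U D ⊗≫ (D ⊗ U) ◁ η_ U D ▷ D ⊗≫
        D ◁ d ▷ (D ⊗ D) ⊗≫ ε_ U D ▷ (U ⊗ (D ⊗ D)) ⊗≫ 𝟙 (U ⊗ (D ⊗ D)))) ⊗≫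
        U ◁ ε_ U D ▷ (D ⊗ D) ⊗≫ 𝟙 _ := by monoidal
    _ = 𝟙 _ ⊗≫ D ◁ η_ U D ⊗≫ (D ⊗ U) ◁ η_ U D ▷ D ⊗≫
        D ◁ d ▷ (D ⊗ D) ⊗≫ ε_ U D ▷ (U ⊗ (D ⊗ D)) ⊗≫
        (η_ U D ▷ U ⊗≫ U ◁ ε_ U D) ▷ (D ⊗ D) ⊗≫ 𝟙 _ := by
      rw [← whisker_exchange]; monoidal
    _ = _ := by rw [ExactPairing.evaluation_coevaluation'']; monoidal

variable [ExactPairing U D] [ExactPairing D U]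

/-- An endomorphism of `D ⊗ U` rotated by a quarter turn. -/
def quarterTurn (f : D ⊗ U ⟶ D ⊗ U) : U ⊗ D ⟶ U ⊗ D :=
  𝟙 _ ⊗≫ (U ⊗ D) ◁ η_ U D ⊗≫ U ◁ f ▷ D ⊗≫ ε_ D U ▷ (U ⊗ D) ⊗≫ 𝟙 _

theorem quarterTurn_id : quarterTurn (𝟙 (D ⊗ U)) = ε_ D U ≫ η_ U D := by
  rw [quarterTurn]
  calc
    _ = 𝟙 _ ⊗≫ ((U ⊗ D) ◁ η_ U D ≫ ε_ D U ▷ (U ⊗ D)) ⊗≫ 𝟙 _ := by monoidal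
    _ = _ := by rw [whisker_exchange]; monoidal

theorem quarterTurn_evaluation_coevaluation : quarterTurn (ε_ U D ≫ η_ D U) = 𝟙 (U ⊗ D) := by
  rw [quarterTurn]
  calc
    _ = 𝟙 _ ⊗≫ U ◁ (D ◁ η_ U D ⊗≫ ε_ U D ▷ D) ⊗≫
        (U ◁ η_ D U ⊗≫ ε_ D U ▷ U) ▷ D ⊗≫ 𝟙 _ := by monoidal
    _ = _ := by
      rw [ExactPairing.coevaluation_evaluation'', ExactPairing.coevaluation_evaluation'']
      monoidal

theorem quarterTurn_turnLeft_turnRight (d : U ⊗ U ⟶ U ⊗ U) :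
    quarterTurn (turnLeft (D := D) d ≫ turnRight d) =
      bridge U D d (mate (D ⊗ D) (D ⊗ D) d) := by
  rw [quarterTurn]
  calc
    _ = 𝟙 _ ⊗≫ U ◁ (𝟙 (𝟙_ C ⊗ D) ⊗≫ D ◁ η_ U D ⊗≫ turnLeft (D := D) d ▷ D ⊗≫ 𝟙 (U ⊗ (D ⊗ D))) ⊗≫
        (U ◁ turnRight (D := D) d ⊗≫ ε_ D U ▷ U) ▷ D ⊗≫ 𝟙 _ := by monoidal
    _ = _ := by
      rw [turnRight_evaluation, ← coevaluation_mate]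
      simp only [bridge, insertCup, insertCap, MonoidalCategory.tensorHom_def']
      monoidal

variable {R : Type*} [CommRing R] [Preadditive C] [Linear R C] [MonoidalPreadditive C]
  [MonoidalLinear R C]

theorem quarterTurn_add_smul (f g : D ⊗ U ⟶ D ⊗ U) (r : R) :
    quarterTurn (f + r • g) = quarterTurn f + r • quarterTurn g := by
  simp [quarterTurn, monoidalComp]

theorem bridge_mate_of_turnLeft_turnRight {d : U ⊗ U ⟶ U ⊗ U} {c : R}
    (h : turnLeft (D := D) d ≫ turnRight d = 𝟙 _ + c • (ε_ U D ≫ η_ D U)) :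
    bridge U D d (mate (D ⊗ D) (D ⊗ D) d) = ε_ D U ≫ η_ U D + c • 𝟙 _ := by
  rw [← quarterTurn_turnLeft_turnRight, h, quarterTurn_add_smul, quarterTurn_id,
    quarterTurn_evaluation_coevaluation]

end Rotation

section Ladders

variable {C : Type*} [Category* C] [MonoidalCategory C] {U D X Y J : C}

/-- The ladder on the strands `X` and `U` that splits a strand `U` off from `X`, applies `d` to the
two adjacent strands `U`, and merges one of them back. -/
def ladder (s : X ⟶ J ⊗ U) (d : U ⊗ U ⟶ U ⊗ U) (m : J ⊗ U ⟶ Y) : X ⊗ U ⟶ Y ⊗ U :=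
  s ▷ U ≫ ((α_ J U U).hom ≫ J ◁ d ≫ (α_ J U U).inv) ≫ m ▷ U

/-- The mirror image of `ladder`. -/
def ladderMirror (s : X ⟶ D ⊗ J) (e : D ⊗ D ⟶ D ⊗ D) (m : D ⊗ J ⟶ Y) : D ⊗ X ⟶ D ⊗ Y :=
  D ◁ s ≫ ((α_ D D J).inv ≫ e ▷ J ≫ (α_ D D J).hom) ≫ D ◁ m

theorem mate_ladder {X' Y' J' : C} [ExactPairing U D] [ExactPairing X X'] [ExactPairing Y Y']
    [ExactPairing J J'] (s : X ⟶ J ⊗ U) (d : U ⊗ U ⟶ U ⊗ U) (m : J ⊗ U ⟶ Y) :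
    mate (D ⊗ X') (D ⊗ Y') (ladder s d m) =
      ladderMirror (mate (D ⊗ J') Y' m) (mate (D ⊗ D) (D ⊗ D) d) (mate X' (D ⊗ J') s) := by
  rw [ladder, mate_comp (Y' := D ⊗ (D ⊗ J')), mate_comp (Y' := D ⊗ (D ⊗ J')),
    mate_comp (Y' := (D ⊗ D) ⊗ J'), mate_comp (Y' := (D ⊗ D) ⊗ J'), mate_associator_hom,
    mate_associator_inv, mate_whiskerLeft, mate_whiskerRight, mate_whiskerRight, ladderMirror]
  simp only [Category.assoc]

variable [ExactPairing U D] [ExactPairing D U] {R : Type*} [CommRing R] [Preadditive C]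
  [Linear R C] [MonoidalPreadditive C] [MonoidalLinear R C]

theorem bridge_ladder_id {d : U ⊗ U ⟶ U ⊗ U} {c : R} (h : closeRight (D := D) d = c • 𝟙 U)
    (s : X ⟶ J ⊗ U) (m : J ⊗ U ⟶ Y) (W : C) :
    bridge U D (ladder s d m) (𝟙 (D ⊗ W)) = c • (s ≫ m) ▷ W := by
  have hcomp := bridge_comp ((α_ J U U).hom ≫ J ◁ d ≫ (α_ J U U).inv) (𝟙 (D ⊗ W)) s (𝟙 W) m (𝟙 W)
  simp only [whiskerLeft_id, Category.comp_id] at hcomp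
  rw [ladder, hcomp, bridge_whiskerLeft, bridge_id_right, h]
  simp

theorem bridge_id_ladderMirror {e : D ⊗ D ⟶ D ⊗ D} {c : R} (h : closeLeft (U := U) e = c • 𝟙 D)
    (s : X ⟶ D ⊗ J) (m : D ⊗ J ⟶ Y) (W : C) :
    bridge U D (𝟙 (W ⊗ U)) (ladderMirror s e m) = c • W ◁ (s ≫ m) := by
  have hcomp := bridge_comp (𝟙 (W ⊗ U)) ((α_ D D J).inv ≫ e ▷ J ≫ (α_ D D J).hom) (𝟙 W) s (𝟙 W) m
  simp only [id_whiskerRight, Category.comp_id] at hcomp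
  rw [ladderMirror, hcomp, bridge_whiskerRight, bridge_id_left, h]
  simp

theorem bridge_ladder_ladderMirror {d : U ⊗ U ⟶ U ⊗ U} {e : D ⊗ D ⟶ D ⊗ D} {c : R}
    (h : bridge U D d e = ε_ D U ≫ η_ U D + c • 𝟙 _) {V W K : C}
    (s : X ⟶ J ⊗ U) (m : J ⊗ U ⟶ Y) (s' : V ⟶ D ⊗ K) (m' : D ⊗ K ⟶ W) :
    bridge U D (ladder s d m) (ladderMirror s' e m') =
      lower U D s s' ≫ raise U D m m' + c • ((s ≫ m) ⊗ₘ (s' ≫ m')) := by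
  rw [ladder, ladderMirror, bridge_comp, bridge_whiskerLeft, bridge_whiskerRight, h]
  simp only [Preadditive.add_comp, Preadditive.comp_add, MonoidalPreadditive.add_whiskerRight,
    MonoidalPreadditive.whiskerLeft_add, MonoidalLinear.whiskerLeft_smul,
    MonoidalLinear.smul_whiskerRight, Linear.smul_comp, Linear.comp_smul]
  congr 1
  · simp only [lower, raise, insertCup, insertCap, MonoidalCategory.tensorHom_def]
    monoidal
  · simp

/-- If `d` is a dumbbell, then `h₂`, `h₁` and `h₀` are the mixed square, the sideway digon and the
circle, `hdigon` is a digon and `hswitch` is the square switch. -/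
theorem raise_comp_lower_eq {d : U ⊗ U ⟶ U ⊗ U} {c₀ c₁ c₂ : R}
    (h₂ : turnLeft (D := D) d ≫ turnRight d = 𝟙 _ + c₂ • (ε_ U D ≫ η_ D U))
    (h₁ : closeRight (D := D) d = c₁ • 𝟙 U) (h₀ : η_ U D ≫ ε_ D U = c₀ • 𝟙 (𝟙_ C))
    {V X' V' J' : C} [ExactPairing X X'] [ExactPairing V V'] [ExactPairing J J'] {n n' : R}
    {s : X ⟶ J ⊗ U} {m : J ⊗ U ⟶ X} (hdigon : s ≫ m = n • 𝟙 X)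
    {s' : V ⟶ X ⊗ U} {m' : X ⊗ U ⟶ V} (hswitch : ladder s d m = m' ≫ s' + n' • 𝟙 _) :
    raise U D m' (mate V' (D ⊗ X') s') ≫ lower U D s' (mate (D ⊗ X') V' m') =
      lower U D s (mate (D ⊗ J') X' m) ≫ raise U D m (mate X' (D ⊗ J') s) +
        (n ^ 2 * c₂ - 2 * (n * n' * c₁) + n' ^ 2 * c₀) • 𝟙 (X ⊗ X') := by
  have hdigon' : mate (D ⊗ J') X' m ≫ mate X' (D ⊗ J') s = n • 𝟙 X' := by
    rw [← mate_comp, hdigon, mate_smul, mate_id]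
  have hswitch' : mate (D ⊗ X') (D ⊗ X') (m' ≫ s') = ladderMirror (mate (D ⊗ J') X' m)
      (mate (D ⊗ D) (D ⊗ D) d) (mate X' (D ⊗ J') s) - n' • 𝟙 _ := by
    rw [eq_sub_iff_add_eq, ← mate_ladder, hswitch, mate_add, mate_smul, mate_id]
  have h₁' : closeLeft (U := U) (mate (D ⊗ D) (D ⊗ D) d) = c₁ • 𝟙 D := by
    rw [← mate_closeRight, h₁, mate_smul, mate_id]
  rw [raise_comp_lower, hswitch', eq_sub_of_add_eq hswitch.symm, bridge_sub_smul_id,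
    bridge_ladder_ladderMirror (bridge_mate_of_turnLeft_turnRight h₂), bridge_ladder_id h₁,
    bridge_id_ladderMirror h₁', bridge_id_id h₀, hdigon, hdigon']
  simp only [MonoidalCategory.tensorHom_def, MonoidalLinear.whiskerLeft_smul,
    MonoidalLinear.smul_whiskerRight, whiskerLeft_id, id_whiskerRight, Linear.comp_smul,
    Category.comp_id]
  module

end Ladders

section QuantumIntegers

variable {F : Type*} [Field F] {t : F}

/-- The balanced quantum integer `[n] = t ^ (1 - n) {n}`, in whose terms both the digon and the
square switch coefficients take a form invariant under `t ↦ t⁻¹`. -/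
def symmQInt (t : F) (n : ℕ) : F := (t ^ n - t⁻¹ ^ n) / (t - t⁻¹)

theorem symmQInt_inv (t : F) (n : ℕ) : symmQInt t⁻¹ n = symmQInt t n := by
  rw [symmQInt, symmQInt, inv_inv, ← neg_div_neg_eq, neg_sub, neg_sub]

theorem symmQInt_one (h : t - t⁻¹ ≠ 0) : symmQInt t 1 = 1 := by
  rw [symmQInt, pow_one, pow_one, div_self h]

theorem mul_symmQInt_succ_sub (h : t - t⁻¹ ≠ 0) (n : ℕ) :
    t * symmQInt t (n + 1) - symmQInt t n = t ^ (n + 1) := by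
  have ht : t * t⁻¹ = 1 := mul_inv_cancel₀ (by rintro rfl; simp at h)
  rw [symmQInt, symmQInt, mul_div_assoc', ← sub_div, div_eq_iff h]
  linear_combination (t ^ n - t⁻¹ ^ n) * ht

theorem inv_mul_symmQInt_succ_sub (h : t - t⁻¹ ≠ 0) (n : ℕ) :
    t⁻¹ * symmQInt t (n + 1) - symmQInt t n = t⁻¹ ^ (n + 1) := by
  rw [← symmQInt_inv t, ← symmQInt_inv t,
    mul_symmQInt_succ_sub (by rwa [inv_inv, ← neg_sub, neg_ne_zero])]

theorem q_ne_zero : q ≠ 0 := RatFunc.X_ne_zero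

theorem q_pow_ne_one {n : ℕ} (hn : n ≠ 0) : q ^ n ≠ 1 := by
  intro h
  have hX : (Polynomial.X ^ n : Polynomial ℚ) = 1 :=
    RatFunc.algebraMap_injective ℚ (by simpa [q] using h)
  simpa [hn] using congrArg Polynomial.natDegree hX

theorem q_sq_sub_one_ne_zero : q ^ 2 - 1 ≠ 0 := sub_ne_zero.2 (q_pow_ne_one two_ne_zero)

theorem q_sub_inv_ne_zero : q - q⁻¹ ≠ 0 := by
  refine right_ne_zero_of_mul (a := q) ?_
  rw [mul_sub, mul_inv_cancel₀ q_ne_zero, ← sq]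
  exact q_sq_sub_one_ne_zero

theorem qInt_one : qInt q 1 = 1 := by
  rw [qInt, mul_one, zpow_ofNat, div_self q_sq_sub_one_ne_zero]

theorem qInt_natCast_ne_zero {n : ℕ} (hn : n ≠ 0) : qInt q n ≠ 0 := by
  have hpow : q ^ (2 * n) - 1 ≠ 0 := sub_ne_zero.2 (q_pow_ne_one (by omega))
  exact div_ne_zero (mod_cast hpow) q_sq_sub_one_ne_zero

theorem zpow_one_sub_mul_qInt (n : ℕ) : q ^ (1 - n : ℤ) * qInt q n = symmQInt q n := by
  have hq := q_ne_zero
  have hq' := q_sq_sub_one_ne_zero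
  rw [qInt, symmQInt, zpow_sub₀ hq, zpow_one, mul_comm 2 (n : ℤ), zpow_mul, zpow_natCast,
    zpow_ofNat, inv_pow]
  field_simp

theorem symmQInt_q_ne_zero {n : ℕ} (hn : n ≠ 0) : symmQInt q n ≠ 0 := by
  rw [← zpow_one_sub_mul_qInt]
  exact mul_ne_zero (zpow_ne_zero _ q_ne_zero) (qInt_natCast_ne_zero hn)

theorem qBinom_succ_self (k : ℕ) : qBinom k (k + 1 : ℕ) = qInt q (k + 1 : ℕ) := by
  have hnum : ∏ i ∈ Finset.range k, qInt q ((k + 1 : ℕ) - i) =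
      ∏ i ∈ Finset.range k, qInt q (i + 2 : ℕ) := by
    rw [← Finset.prod_range_reflect]
    refine Finset.prod_congr rfl fun i hi => ?_
    rw [Finset.mem_range] at hi
    congr 1
    omega
  have hfactorial : ∏ i ∈ Finset.range (k + 1), qInt q (i + 1 : ℕ) =
      ∏ i ∈ Finset.range k, qInt q (i + 2 : ℕ) := by
    rw [Finset.prod_range_succ', zero_add, Nat.cast_one, qInt_one, mul_one]
  have hden : ∏ i ∈ Finset.range k, qInt q (i + 1 : ℕ) ≠ 0 :=
    Finset.prod_ne_zero_iff.2 fun i _ => qInt_natCast_ne_zero i.succ_ne_zero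
  rw [qBinom, Finset.prod_div_distrib, hnum, ← hfactorial, Finset.prod_range_succ]
  exact mul_div_cancel_left₀ _ (mod_cast hden)

theorem digon_coefficient (k : ℕ) :
    q⁻¹ ^ (k * 1) * qBinom k (k + 1 : ℕ) = symmQInt q (k + 1) := by
  rw [qBinom_succ_self, ← zpow_one_sub_mul_qInt, mul_one, inv_pow, ← zpow_natCast, ← zpow_neg]
  congr 2
  push_cast
  ring

theorem switch_coefficient (k : ℕ) :
    q ^ (1 - (k + 1 : ℕ) + (1 : ℕ) : ℤ) * qInt q ((k + 1 : ℕ) - (1 : ℕ)) = symmQInt q k := by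
  rw [← zpow_one_sub_mul_qInt]
  congr 2 <;> push_cast <;> ring

end QuantumIntegers

section Coefficients

variable {R : Type*} [CommRing R] [Algebra (RatFunc ℚ) R] (a : Rˣ)

theorem circleVal_one : circleVal a 1 = aInt a 0 := by
  simp [circleVal, qInt_one]

theorem isUnit_circleVal {a : Rˣ} (ha : ∀ r, IsUnit (aInt a r)) (k : ℕ) :
    IsUnit (circleVal a k) := by
  have hfactorial : ∏ i ∈ Finset.range k, qInt q (i + 1) ≠ 0 :=
    Finset.prod_ne_zero_iff.2 fun i _ => mod_cast qInt_natCast_ne_zero i.succ_ne_zero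
  rw [circleVal, Algebra.smul_def]
  exact ((div_ne_zero (pow_ne_zero _ q_ne_zero) hfactorial).isUnit.map _).mul
    (IsUnit.prod_iff.2 fun i _ => ha i)

theorem symmQInt_smul_aInt_sub (r n : ℕ) :
    symmQInt q (n + 1) • aInt a (r + 1) - symmQInt q n • aInt a r = aInt a (r + n + 1) := by
  have hinv : symmQInt q (n + 1) * q⁻¹ ^ (r + 1) - symmQInt q n * q⁻¹ ^ r = q⁻¹ ^ (r + n + 1) := by
    linear_combination q⁻¹ ^ r * inv_mul_symmQInt_succ_sub q_sub_inv_ne_zero n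
  have hpow : symmQInt q (n + 1) * q ^ (r + 1) - symmQInt q n * q ^ r = q ^ (r + n + 1) := by
    linear_combination q ^ r * mul_symmQInt_succ_sub q_sub_inv_ne_zero n
  rw [aInt, aInt, aInt, ← hinv, ← hpow]
  simp only [Algebra.smul_def, map_sub, map_mul]
  ring

theorem raise_lower_coefficient (k : ℕ) :
    algebraMap _ R (symmQInt q (k + 1)) ^ 2 * aInt a 2 -
        2 * (algebraMap _ R (symmQInt q (k + 1)) * algebraMap _ R (symmQInt q k) * aInt a 1) +
      algebraMap _ R (symmQInt q k) ^ 2 * aInt a 0 = aInt a (2 * (k + 1)) := by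
  have h₁ := symmQInt_smul_aInt_sub a 0 k
  have h₂ := symmQInt_smul_aInt_sub a 1 k
  have h₃ := symmQInt_smul_aInt_sub a (k + 1) k
  rw [show k + 1 + k + 1 = 2 * (k + 1) by ring] at h₃
  rw [show 0 + k + 1 = k + 1 by ring] at h₁
  rw [show 1 + k + 1 = k + 1 + 1 by ring] at h₂
  simp only [Algebra.smul_def] at h₁ h₂ h₃
  linear_combination algebraMap _ R (symmQInt q (k + 1)) * h₂ -
    algebraMap _ R (symmQInt q k) * h₁ + h₃

end Coefficients

section WebCategory

variable {C : Type*} [Category* C] [MonoidalCategory C]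

/-- An exact pairing from zigzag relations that are closed up by unitors. -/
@[reducible]
def exactPairingOfZigzag {X Y : C} (η : 𝟙_ C ⟶ X ⊗ Y) (ε : Y ⊗ X ⟶ 𝟙_ C)
    (h₁ : (ρ_ Y).inv ≫ Y ◁ η ≫ (α_ Y X Y).inv ≫ ε ▷ Y ≫ (λ_ Y).hom = 𝟙 Y)
    (h₂ : (λ_ X).inv ≫ η ▷ X ≫ (α_ X Y X).hom ≫ X ◁ ε ≫ (ρ_ X).hom = 𝟙 X) :
    ExactPairing X Y where
  coevaluation' := η
  evaluation' := ε
  coevaluation_evaluation' := by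
    rw [Iso.inv_comp_eq, Category.comp_id] at h₁
    rw [Iso.eq_comp_inv, ← h₁]
    simp only [Category.assoc]
  evaluation_coevaluation' := by
    rw [Iso.inv_comp_eq, Category.comp_id] at h₂
    rw [Iso.eq_comp_inv, ← h₂]
    simp only [Category.assoc]

variable {R : Type*} [CommRing R] [Algebra (RatFunc ℚ) R] (a : Rˣ)

open WebHom

instance : MonoidalPreadditive (InfWeb a) where
  whiskerLeft_zero {X Y Z} := by
    have h : ∀ f : Y ⟶ Z, X ◁ ((0 : R) • f) = (0 : R) • (X ◁ f) := fun f => by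
      induction f using ind with | h f => exact sound (WebRel.tensor_smul _ _ _)
    simpa using h 0
  zero_whiskerRight {X Y Z} := by
    have h : ∀ f : Y ⟶ Z, ((0 : R) • f) ▷ X = (0 : R) • (f ▷ X) := fun f => by
      induction f using ind with | h f => exact sound (WebRel.smul_tensor _ _ _)
    simpa using h 0
  whiskerLeft_add f g := by
    induction f using ind with | h f =>
    induction g using ind with | h g => exact sound (WebRel.tensor_add _ _ _)
  add_whiskerRight f g := by
    induction f using ind with | h f =>
    induction g using ind with | h g => exact sound (WebRel.add_tensor _ _ _)

instance : MonoidalLinear R (InfWeb a) where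
  whiskerLeft_smul X _ _ r f := by
    induction f using ind with | h f => exact sound (WebRel.tensor_smul _ _ _)
  smul_whiskerRight r _ _ f X := by
    induction f using ind with | h f => exact sound (WebRel.smul_tensor _ _ _)

/-- The upward strand labelled `k`, as an object of the web category. -/
def upObj (k : ℕ) : InfWeb a := ⟨up k⟩

/-- The downward strand labelled `k`, as an object of the web category. -/
def dnObj (k : ℕ) : InfWeb a := ⟨dn k⟩

/-- The merge vertex as a morphism. -/
def webMerge (k l m : ℕ) (h : k + l = m) : upObj a k ⊗ upObj a l ⟶ upObj a m :=
  mk a (WebTm.merge k l m h)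

/-- The split vertex as a morphism. -/
def webSplit (k l m : ℕ) (h : k + l = m) : upObj a m ⟶ upObj a k ⊗ upObj a l :=
  mk a (WebTm.split k l m h)

instance exactPairingUpDn (k : ℕ) : ExactPairing (upObj a k) (dnObj a k) :=
  exactPairingOfZigzag (mk a (WebTm.cupL k)) (mk a (WebTm.capL k))
    (sound (WebRel.zigzag_down_left k)) (sound (WebRel.zigzag_up_left k))

instance exactPairingDnUp (k : ℕ) : ExactPairing (dnObj a k) (upObj a k) :=
  exactPairingOfZigzag (mk a (WebTm.cupR k)) (mk a (WebTm.capR k))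
    (sound (WebRel.zigzag_up_right k)) (sound (WebRel.zigzag_down_right k))

/-- The web `(k↑, k↓) → ((k+1)↑, (k+1)↓)` that creates an inner cup and merges it with the outer
strands. -/
def webRaise (k : ℕ) : upDown a k ⟶ upDown a (k + 1) :=
  raise (upObj a 1) (dnObj a 1) (webMerge a k 1 (k + 1) rfl)
    (mate (dnObj a (k + 1)) (dnObj a 1 ⊗ dnObj a k) (webSplit a k 1 (k + 1) rfl))

/-- The web `((k+1)↑, (k+1)↓) → (k↑, k↓)` that splits off an inner cap. -/
def webLower (k : ℕ) : upDown a (k + 1) ⟶ upDown a k :=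
  lower (upObj a 1) (dnObj a 1) (webSplit a k 1 (k + 1) rfl)
    (mate (dnObj a 1 ⊗ dnObj a k) (dnObj a (k + 1)) (webMerge a k 1 (k + 1) rfl))

/-- `(k↑, k↓) → ((k-1)↑, (k-1)↓) → (k↑, k↓)`; it is zero if `k = 0` (negative label). -/
def webLowerRaise : (k : ℕ) → (upDown a k ⟶ upDown a k)
  | 0 => 0
  | k + 1 => webLower a k ≫ webRaise a k

/-- The `m`-fold composite `(j↑, j↓) → ((j+m)↑, (j+m)↓)` of the webs `webRaise`. -/
def iterRaise (j : ℕ) : (m : ℕ) → (upDown a j ⟶ upDown a (j + m))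
  | 0 => 𝟙 _
  | m + 1 => iterRaise j m ≫ webRaise a (j + m)

/-- Two upward strands labelled `1` that merge and split again. -/
def webDumbbell : upObj a 1 ⊗ upObj a 1 ⟶ upObj a 1 ⊗ upObj a 1 :=
  webMerge a 1 1 2 rfl ≫ webSplit a 1 1 2 rfl

theorem coevaluation_evaluation_upObj_one :
    η_ (upObj a 1) (dnObj a 1) ≫ ε_ (dnObj a 1) (upObj a 1) = aInt a 0 • 𝟙 (𝟙_ (InfWeb a)) := by
  rw [← circleVal_one]
  exact sound (WebRel.circle_cw 1)

theorem closeRight_webDumbbell :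
    closeRight (D := dnObj a 1) (webDumbbell a) = aInt a 1 • 𝟙 (upObj a 1) :=
  sound WebRel.side_digon_right

theorem turnLeft_comp_turnRight_webDumbbell :
    turnLeft (D := dnObj a 1) (webDumbbell a) ≫ turnRight (webDumbbell a) =
      𝟙 _ + aInt a 2 • (ε_ (upObj a 1) (dnObj a 1) ≫ η_ (dnObj a 1) (upObj a 1)) := by
  have hleft : turnLeft (D := dnObj a 1) (webDumbbell a) = mk a WebTm.sideL := rfl
  have hright : turnRight (D := dnObj a 1) (webDumbbell a) = mk a WebTm.sideR := rfl
  rw [hleft, hright]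
  exact sound WebRel.square_mirror

theorem webSplit_comp_webMerge (k : ℕ) :
    webSplit a k 1 (k + 1) rfl ≫ webMerge a k 1 (k + 1) rfl =
      algebraMap _ R (symmQInt q (k + 1)) • 𝟙 (upObj a (k + 1)) := by
  rw [← digon_coefficient]
  exact sound (WebRel.digon k 1 (k + 1) rfl)

theorem mk_ladderLR_one (k : ℕ) :
    mk a (WebTm.ladderLR k 1) = webMerge a k 1 (k + 1) rfl ≫ webSplit a k 1 (k + 1) rfl := by
  have hsplit : webSplit a 1 0 1 rfl = (ρ_ (upObj a 1)).inv := sound (WebRel.split_zero_right 1)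
  have hmerge : webMerge a 1 0 1 rfl = (ρ_ (upObj a 1)).hom := sound (WebRel.merge_zero_right 1)
  change (upObj a k ◁ webSplit a 1 0 1 rfl ≫ (α_ (upObj a k) (upObj a 1) (𝟙_ (InfWeb a))).inv ≫
      webMerge a k 1 (k + 1) rfl ▷ 𝟙_ (InfWeb a)) ≫
    (webSplit a k 1 (k + 1) rfl ▷ 𝟙_ (InfWeb a) ≫
      (α_ (upObj a k) (upObj a 1) (𝟙_ (InfWeb a))).hom ≫ upObj a k ◁ webMerge a 1 0 1 rfl) = _
  rw [hsplit, hmerge]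
  monoidal

theorem mk_ladderRL_one (k : ℕ) :
    mk a (WebTm.ladderRL (k + 1) 1) =
      ladder (webSplit a k 1 (k + 1) rfl) (webDumbbell a) (webMerge a k 1 (k + 1) rfl) := by
  change (webSplit a k 1 (k + 1) rfl ▷ upObj a 1 ≫
      (α_ (upObj a k) (upObj a 1) (upObj a 1)).hom ≫ upObj a k ◁ webMerge a 1 1 2 rfl) ≫
    (upObj a k ◁ webSplit a 1 1 2 rfl ≫ (α_ (upObj a k) (upObj a 1) (upObj a 1)).inv ≫
      webMerge a k 1 (k + 1) rfl ▷ upObj a 1) = _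
  simp [ladder, webDumbbell]

theorem ladder_webDumbbell (k : ℕ) :
    ladder (webSplit a k 1 (k + 1) rfl) (webDumbbell a) (webMerge a k 1 (k + 1) rfl) =
      webMerge a (k + 1) 1 (k + 2) rfl ≫ webSplit a (k + 1) 1 (k + 2) rfl +
        algebraMap _ R (symmQInt q k) • 𝟙 _ := by
  have hswitch := sound (WebRel.square_switch (a := a) (k + 1) 1)
  rw [WebHom.mk_add, mk_ladderLR_one, mk_ladderRL_one] at hswitch
  rw [← switch_coefficient]
  exact hswitch

theorem webRaise_comp_webLower_zero :
    webRaise a 0 ≫ webLower a 0 = aInt a 0 • 𝟙 (upDown a 0) := by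
  have hmerge : webMerge a 0 1 1 rfl = (λ_ (upObj a 1)).hom := sound (WebRel.merge_zero_left 1)
  have hsplit : webSplit a 0 1 1 rfl = (λ_ (upObj a 1)).inv := sound (WebRel.split_zero_left 1)
  have hid : webMerge a 0 1 1 rfl ≫ webSplit a 0 1 1 rfl = 𝟙 (upObj a 0 ⊗ upObj a 1) := by
    rw [hmerge, hsplit]
    exact (λ_ (upObj a 1)).hom_inv_id
  refine (raise_comp_lower (U := upObj a 1) (D := dnObj a 1) (X := upObj a 0) (X' := dnObj a 0)
    (V := upObj a 1) (V' := dnObj a 1) (webMerge a 0 1 1 rfl) (webSplit a 0 1 1 rfl)).trans ?_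
  rw [hid, mate_id]
  exact bridge_id_id (coevaluation_evaluation_upObj_one a) _ _

theorem webRaise_comp_webLower (k : ℕ) :
    webRaise a k ≫ webLower a k = webLowerRaise a k + aInt a (2 * k) • 𝟙 (upDown a k) := by
  cases k with
  | zero => rw [webRaise_comp_webLower_zero, webLowerRaise, zero_add, mul_zero]
  | succ k =>
    rw [← raise_lower_coefficient]
    exact raise_comp_lower_eq (U := upObj a 1) (D := dnObj a 1) (X := upObj a (k + 1))
      (X' := dnObj a (k + 1)) (V := upObj a (k + 2)) (V' := dnObj a (k + 2)) (J := upObj a k)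
      (J' := dnObj a k)
      (turnLeft_comp_turnRight_webDumbbell a) (closeRight_webDumbbell a)
      (coevaluation_evaluation_upObj_one a) (webSplit_comp_webMerge a k) (ladder_webDumbbell a k)

theorem iterRaise_succ_comp_webLower (j m : ℕ) :
    iterRaise a j (m + 1) ≫ webLower a (j + m) =
      webLowerRaise a j ≫ iterRaise a j m +
        (symmQInt q (m + 1) • aInt a (2 * j + m)) • iterRaise a j m := by
  induction m with
  | zero =>
    simpa [iterRaise, symmQInt_one q_sub_inv_ne_zero] using webRaise_comp_webLower a j
  | succ m ih =>
    have hcoeff := symmQInt_smul_aInt_sub a (2 * j + m) (m + 1)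
    rw [show 2 * j + m + (m + 1) + 1 = 2 * (j + (m + 1)) by ring, sub_eq_iff_eq_add'] at hcoeff
    calc
      iterRaise a j (m + 1 + 1) ≫ webLower a (j + (m + 1))
        = iterRaise a j (m + 1) ≫ webRaise a (j + (m + 1)) ≫ webLower a (j + (m + 1)) :=
          Category.assoc _ _ _
      _ = (iterRaise a j (m + 1) ≫ webLower a (j + m)) ≫ webRaise a (j + m) +
          aInt a (2 * (j + (m + 1))) • iterRaise a j (m + 1) := by
        rw [webRaise_comp_webLower, Preadditive.comp_add, Linear.comp_smul, Category.comp_id]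
        exact congrArg (· + _) (Category.assoc _ _ _).symm
      _ = _ := by
        rw [ih, Preadditive.add_comp, Category.assoc, Linear.smul_comp]
        refine (add_assoc _ _ _).trans (congrArg (webLowerRaise a j ≫ iterRaise a j (m + 1) + ·) ?_)
        exact (add_smul _ _ _).symm.trans (congrArg (· • iterRaise a j (m + 1)) hcoeff.symm)

end WebCategory

section Values

variable {K : Type*} [Field K] {c : K} {f g : RatFunc K} {v w : K}

/-- The rational function `f` has no pole at `c`, and its value there is `v`.  (`RatFunc.eval` alone
returns `0` at a pole, and hence is neither additive nor multiplicative.) -/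
def HasValueAt (c : K) (f : RatFunc K) (v : K) : Prop :=
  f.denom.eval c ≠ 0 ∧ f.eval (RingHom.id K) c = v

namespace HasValueAt

theorem unique (hf : HasValueAt c f v) (hf' : HasValueAt c f w) : v = w :=
  hf.2.symm.trans hf'.2

theorem intCast (n : ℤ) : HasValueAt c (n : RatFunc K) n := by
  rw [← map_intCast (RatFunc.C (K := K)) n]
  exact ⟨by rw [RatFunc.denom_C]; simp, RatFunc.eval_C _ _⟩

theorem one : HasValueAt c (1 : RatFunc K) 1 := by
  simpa using intCast (c := c) 1

theorem X : HasValueAt c (RatFunc.X : RatFunc K) c := ⟨by simp, by simp⟩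

theorem add (hf : HasValueAt c f v) (hg : HasValueAt c g w) : HasValueAt c (f + g) (v + w) := by
  refine ⟨fun h => ?_, by rw [RatFunc.eval_add _ _ hf.1 hg.1, hf.2, hg.2]⟩
  have hdvd := Polynomial.eval_dvd (x := c) (RatFunc.denom_add_dvd f g)
  rw [h, zero_dvd_iff, Polynomial.eval_mul] at hdvd
  exact mul_ne_zero hf.1 hg.1 hdvd

theorem mul (hf : HasValueAt c f v) (hg : HasValueAt c g w) : HasValueAt c (f * g) (v * w) := by
  refine ⟨fun h => ?_, by rw [RatFunc.eval_mul _ _ hf.1 hg.1, hf.2, hg.2]⟩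
  have hdvd := Polynomial.eval_dvd (x := c) (RatFunc.denom_mul_dvd f g)
  rw [h, zero_dvd_iff, Polynomial.eval_mul] at hdvd
  exact mul_ne_zero hf.1 hg.1 hdvd

theorem inv (hf : HasValueAt c f v) (hv : v ≠ 0) : HasValueAt c f⁻¹ v⁻¹ := by
  have hf₀ : f ≠ 0 := by
    rintro rfl
    exact hv (by simpa using hf.2.symm)
  have hnum : f.num.eval c ≠ 0 := fun h =>
    hv (hf.2.symm.trans (by rw [RatFunc.eval, Polynomial.eval₂_id, h, zero_div]))
  have hdenom : f⁻¹.denom.eval c ≠ 0 := fun h => by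
    have hdvd := Polynomial.eval_dvd (x := c) (RatFunc.denom_inv_dvd hf₀)
    rw [h, zero_dvd_iff] at hdvd
    exact hnum hdvd
  have hmul := RatFunc.eval_mul (RingHom.id K) c hf.1 hdenom
  rw [mul_inv_cancel₀ hf₀, RatFunc.eval_one, hf.2] at hmul
  exact ⟨hdenom, eq_inv_of_mul_eq_one_right hmul.symm⟩

theorem zpow (hf : HasValueAt c f 1) (hf₀ : f ≠ 0) (n : ℤ) : HasValueAt c (f ^ n) 1 := by
  induction n with
  | zero => simpa using one
  | succ n ih => simpa [zpow_add_one₀ hf₀] using ih.mul hf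
  | pred n ih => simpa [zpow_sub_one₀ hf₀] using ih.mul (hf.inv one_ne_zero)

end HasValueAt

end Values

section QRationals

theorem qInt_add_one {t : RatFunc ℚ} (ht : t ≠ 0) (ht' : t ^ 2 - 1 ≠ 0) (n : ℤ) :
    qInt t (n + 1) = t ^ 2 * qInt t n + 1 := by
  have hpow : t ^ (2 * (n + 1)) = t ^ 2 * t ^ (2 * n) := by
    rw [mul_add_one, zpow_add₀ ht, mul_comm, zpow_ofNat]
  rw [qInt, qInt, hpow]
  field_simp
  ring

section Specialisation

variable {c : ℚ} {t : RatFunc ℚ}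

theorem hasValueAt_qInt (h : HasValueAt c t 1) (ht : t ≠ 0) (ht' : t ^ 2 - 1 ≠ 0) (n : ℤ) :
    HasValueAt c (qInt t n) n := by
  have hsq : HasValueAt c (t ^ 2) 1 := by simpa using h.zpow ht 2
  induction n with
  | zero => simpa [qInt] using HasValueAt.intCast (c := c) 0
  | succ n ih => simpa [qInt_add_one ht ht'] using (hsq.mul ih).add HasValueAt.one
  | pred n ih =>
    have hpred : qInt t (-n - 1) = (t ^ 2)⁻¹ * (qInt t (-n) + (-1 : ℤ)) := by
      rw [eq_inv_mul_iff_mul_eq₀ (pow_ne_zero 2 ht), ← sub_add_cancel (-n : ℤ) 1,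
        qInt_add_one ht ht']
      simp
    rw [hpred]
    simpa [sub_eq_add_neg] using (hsq.inv one_ne_zero).mul (ih.add (HasValueAt.intCast (-1)))

theorem hasValueAt_qInt_add_zpow_div (h : HasValueAt c t 1) (ht : t ≠ 0) (ht' : t ^ 2 - 1 ≠ 0)
    (n : ℤ) {g : RatFunc ℚ} {v : ℚ} (hg : HasValueAt c g v) (hv : v ≠ 0) :
    HasValueAt c (qInt t n + t ^ (2 * n) / g) (n + v⁻¹) := by
  simpa [div_eq_mul_inv] using
    (hasValueAt_qInt h ht ht' n).add ((h.zpow ht (2 * n)).mul (hg.inv hv))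

end Specialisation

theorem hasValueAt_one_q : HasValueAt 1 q 1 := HasValueAt.X

theorem hasValueAt_one_q_inv : HasValueAt 1 q⁻¹ 1 := by
  simpa using hasValueAt_one_q.inv one_ne_zero

theorem q_inv_sq_sub_one_ne_zero : q⁻¹ ^ 2 - 1 ≠ 0 := by
  rw [inv_pow, sub_ne_zero, Ne, inv_eq_one]
  exact q_pow_ne_one two_ne_zero

theorem qCF_evenCF_cons_cons (a b : ℤ) (z : ℚ) :
    qCF (a :: b :: evenCF z) =
      qInt q a + q ^ (2 * a) / (qInt q⁻¹ b + q⁻¹ ^ (2 * b) / qCF (evenCF z)) := by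
  rw [evenCF, inv_zpow', ← neg_mul]
  split_ifs <;> exact qCF.eq_4 _ _ _ _

theorem hasValueAt_one_qRat (x : ℚ) : HasValueAt 1 (qRat x) x := by
  have hremainder (x : ℚ) : (x - (⌈x⌉ - 1 : ℤ))⁻¹ ≠ 0 := by
    refine inv_ne_zero (sub_ne_zero.2 ?_)
    push_cast
    exact (sub_lt_iff_lt_add.2 (Int.ceil_lt_add_one x)).ne'
  have houter (n : ℤ) {g : RatFunc ℚ} {v : ℚ} (hg : HasValueAt 1 g v) (hv : v ≠ 0) :
      HasValueAt 1 (qInt q n + q ^ (2 * n) / g) (n + v⁻¹) :=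
    hasValueAt_qInt_add_zpow_div hasValueAt_one_q q_ne_zero q_sq_sub_one_ne_zero n hg hv
  have hinner (n : ℤ) {g : RatFunc ℚ} {v : ℚ} (hg : HasValueAt 1 g v) (hv : v ≠ 0) :
      HasValueAt 1 (qInt q⁻¹ n + q⁻¹ ^ (2 * n) / g) (n + v⁻¹) :=
    hasValueAt_qInt_add_zpow_div hasValueAt_one_q_inv (inv_ne_zero q_ne_zero)
      q_inv_sq_sub_one_ne_zero n hg hv
  rw [qRat]
  induction x using evenCF.induct with
  | case1 x h =>
    have hlast := hasValueAt_qInt hasValueAt_one_q_inv (inv_ne_zero q_ne_zero)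
      q_inv_sq_sub_one_ne_zero ⌊(x - (⌈x⌉ - 1 : ℤ))⁻¹⌋
    rw [← h] at hlast
    rw [evenCF, if_pos h, qCF]
    simpa only [inv_inv, add_sub_cancel] using houter (⌈x⌉ - 1) hlast (hremainder x)
  | case2 x h ih =>
    have htail := hinner ⌊(x - (⌈x⌉ - 1 : ℤ))⁻¹⌋ ih (inv_ne_zero (sub_ne_zero.2 h))
    rw [inv_inv, add_sub_cancel] at htail
    rw [evenCF, if_neg h, qCF_evenCF_cons_cons]
    simpa only [inv_inv, add_sub_cancel] using houter (⌈x⌉ - 1) htail (hremainder x)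

theorem qInt_add_zpow_mul_eq (n : ℤ) (g : RatFunc ℚ) :
    qInt q n + q ^ (2 * n) * g = q ^ 2 * (qInt q (n - 1) + q ^ (2 * (n - 1)) * g) + 1 := by
  have hint := qInt_add_one q_ne_zero q_sq_sub_one_ne_zero (n - 1)
  have hpow : q ^ (2 * n) = q ^ 2 * q ^ (2 * (n - 1)) := by
    rw [← zpow_ofNat, ← zpow_add₀ q_ne_zero]
    congr 1
    ring
  rw [sub_add_cancel] at hint
  rw [hint, hpow]
  ring

theorem qCF_cons_eq (n : ℤ) {l : List ℤ} (hl : l ≠ []) :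
    qCF (n :: l) = q ^ 2 * qCF ((n - 1) :: l) + 1 := by
  match l, hl with
  | [b], _ | b :: c :: l, _ =>
    simp only [qCF, div_eq_mul_inv]
    exact qInt_add_zpow_mul_eq n _

theorem exists_evenCF_eq_cons (x : ℚ) :
    ∃ l ≠ [], evenCF x = (⌈x⌉ - 1) :: l ∧ evenCF (x - 1) = (⌈x⌉ - 1 - 1) :: l := by
  have hremainder : x - 1 - (⌈x - 1⌉ - 1 : ℤ) = x - (⌈x⌉ - 1 : ℤ) := by
    rw [Int.ceil_sub_one]
    push_cast
    ring
  rw [evenCF.eq_def x, evenCF.eq_def (x - 1), hremainder, Int.ceil_sub_one]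
  split_ifs <;> exact ⟨_, by simp, rfl, rfl⟩

theorem qRat_eq (x : ℚ) : qRat x = q ^ 2 * qRat (x - 1) + 1 := by
  obtain ⟨l, hl, hx, hx'⟩ := exists_evenCF_eq_cons x
  rw [qRat, qRat, hx, hx', qCF_cons_eq _ hl]

theorem q_sq_mul_qDelta (x : ℚ) : q ^ 2 * qDelta x = (q ^ 2 - 1) * qRat x + 1 := by
  rw [qDelta]
  linear_combination qRat_eq x

theorem q_sq_mul_qDelta_ne {x : ℚ} {n : ℤ} (h : x ≠ n) : q ^ 2 * qDelta x ≠ q ^ (2 * n) := by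
  intro hdelta
  have hqRat : qRat x = qInt q n := by
    rw [qInt, eq_div_iff q_sq_sub_one_ne_zero]
    linear_combination hdelta - q_sq_mul_qDelta x
  have hn := hasValueAt_qInt hasValueAt_one_q q_ne_zero q_sq_sub_one_ne_zero n
  exact h ((hqRat ▸ hasValueAt_one_qRat x).unique hn)

variable {R : Type*} [CommRing R] [Algebra (RatFunc ℚ) R]

theorem isUnit_aInt_xParam {x : ℚ} {r : ℕ} (hx : x ≠ r) (ν : R)
    (hν : ν ^ 2 * algebraMap (RatFunc ℚ) R (qDelta x) = 1) : IsUnit (aInt (xParam x ν hν) r) := by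
  have hq := q_ne_zero
  have hν' : IsUnit ν := (isUnit_pow_iff two_ne_zero).1 (IsUnit.of_mul_eq_one _ hν)
  have hfactor : aInt (xParam x ν hν) r = ν * algebraMap (RatFunc ℚ) R
      ((q - q⁻¹)⁻¹ * (q⁻¹ ^ r * (q * qDelta x) - q ^ r * q⁻¹)) := by
    simp only [aInt, xParam, Units.inv_mk, Algebra.smul_def, map_mul, map_sub]
    ring
  have hne : q⁻¹ ^ r * (q * qDelta x) - q ^ r * q⁻¹ ≠ 0 := by
    refine right_ne_zero_of_mul (a := q * q ^ r) ?_
    have hdelta : q ^ 2 * qDelta x - q ^ (2 * r) ≠ 0 :=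
      sub_ne_zero.2 (mod_cast q_sq_mul_qDelta_ne (n := r) (mod_cast hx))
    convert hdelta using 1
    rw [inv_pow, mul_comm 2 r, pow_mul]
    field_simp
  rw [hfactor]
  exact hν'.mul ((mul_ne_zero (inv_ne_zero q_sub_inv_ne_zero) hne).isUnit.map _)

end QRationals

section NonUnitalAlgebras

variable {R A ι : Type*}

theorem linearIndependent_of_orthogonal_idempotents [Ring R] [NonUnitalNonAssocRing A] [Module R A]
    [SMulCommClass R A A] {e : ι → A} (hidem : ∀ i, IsIdempotentElem (e i))
    (hortho : Pairwise fun i j => e i * e j = 0) (htorsion : ∀ i (r : R), r • e i = 0 → r = 0) :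
    LinearIndependent R e := by
  rw [linearIndependent_iff']
  intro s g hg i hi
  refine htorsion i (g i) ?_
  calc
    g i • e i = ∑ j ∈ s, e i * (g j • e j) := by
      rw [Finset.sum_eq_single_of_mem i hi fun j _ hj => by
        rw [mul_smul_comm, hortho hj.symm, smul_zero], mul_smul_comm, (hidem i).eq]
    _ = 0 := by rw [← Finset.mul_sum, hg, mul_zero]

theorem eventually_forall_mul_eq_zero [Semiring R] [NonUnitalNonAssocSemiring A] [Module R A]
    [SMulCommClass R A A] [Module.Finite R A] {l : Filter ι} {e : ι → A}
    (h : ∀ b, ∀ᶠ k in l, e k * b = 0) : ∀ᶠ k in l, ∀ b, e k * b = 0 := by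
  obtain ⟨S, hS⟩ := Module.Finite.fg_top (R := R) (M := A)
  filter_upwards [(Filter.eventually_all_finset S).2 fun b _ => h b] with k hk
  exact LinearMap.congr_fun (LinearMap.ext_on (f := LinearMap.mulLeft R (e k)) (g := 0) hS hk)

end NonUnitalAlgebras

section SchurAlgebra

variable {R : Type*} [CommRing R] [Algebra (RatFunc ℚ) R] (a : Rˣ)

theorem webCup_comp_webCap (k : ℕ) :
    webCup a k ≫ webCap a k = circleVal a k • 𝟙 (𝟙_ (InfWeb a)) :=
  WebHom.sound (WebRel.circle_cw k)

/-- The object `(0↑, 0↓)` is the tensor square of the unit object, hence isomorphic but not equal to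
it. -/
def upDownZeroIso : upDown a 0 ≅ 𝟙_ (InfWeb a) := λ_ (𝟙_ (InfWeb a))

namespace Schur

/-- The identity of `(k↑, k↓)`, as an element of the Schur algebra. -/
def idEntry (k : ℕ) : Schur a := entry a k k (𝟙 (upDown a k))

/-- The cap labelled `k`, as an element of the Schur algebra. -/
def capEntry (k : ℕ) : Schur a := entry a k 0 (webCap a k ≫ (upDownZeroIso a).inv)

/-- The cup labelled `k`, as an element of the Schur algebra. -/
def cupEntry (k : ℕ) : Schur a := entry a 0 k ((upDownZeroIso a).hom ≫ webCup a k)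

theorem cupEntry_mul_capEntry (k : ℕ) : cupEntry a k * capEntry a k = capCup a k := by
  rw [cupEntry, capEntry, entry_mul_entry_self, Category.assoc, Iso.inv_hom_id_assoc, capCup]

theorem capEntry_mul_cupEntry (k : ℕ) :
    capEntry a k * cupEntry a k = circleVal a k • emptyWeb a := by
  rw [capEntry, cupEntry, entry_mul_entry_self, emptyWeb, ← map_smul]
  congr 1
  calc
    ((upDownZeroIso a).hom ≫ webCup a k) ≫ webCap a k ≫ (upDownZeroIso a).inv
      = (upDownZeroIso a).hom ≫ (webCup a k ≫ webCap a k) ≫ (upDownZeroIso a).inv := by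
        simp only [Category.assoc]
    _ = circleVal a k • 𝟙 (upDown a 0) := by
      rw [webCup_comp_webCap, Linear.smul_comp, Category.id_comp, Linear.comp_smul, Iso.hom_inv_id]

theorem emptyWeb_mul_capEntry (k : ℕ) : emptyWeb a * capEntry a k = capEntry a k := by
  rw [emptyWeb, capEntry, entry_mul_entry_self, Category.comp_id]

theorem emptyWeb_mul_emptyWeb : emptyWeb a * emptyWeb a = emptyWeb a := by
  rw [emptyWeb, entry_mul_entry_self, Category.comp_id]

theorem capCup_mul_capCup (k l : ℕ) :
    capCup a k * capCup a l = if k = l then circleVal a k • capCup a k else 0 := by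
  split_ifs with h
  · subst h
    calc
      capCup a k * capCup a k = cupEntry a k * (capEntry a k * cupEntry a k * capEntry a k) := by
        simp only [← cupEntry_mul_capEntry, mul_assoc]
      _ = circleVal a k • capCup a k := by
        rw [capEntry_mul_cupEntry, smul_mul_assoc, emptyWeb_mul_capEntry, mul_smul_comm,
          cupEntry_mul_capEntry]
  · exact entry_mul_entry_of_ne a _ _ _ _ (Ne.symm h) _ _

theorem capEntry_mul_capCup_mul_cupEntry (k : ℕ) :
    capEntry a k * capCup a k * cupEntry a k = (circleVal a k * circleVal a k) • emptyWeb a := by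
  calc
    _ = capEntry a k * cupEntry a k * (capEntry a k * cupEntry a k) := by
      simp only [← cupEntry_mul_capEntry, mul_assoc]
    _ = _ := by rw [capEntry_mul_cupEntry, smul_mul_smul_comm, emptyWeb_mul_emptyWeb]

variable {a} (ha : ∀ r, IsUnit (aInt a r))

include ha in
theorem idem_mul_idem (k l : ℕ) : idem a k * idem a l = if k = l then idem a k else 0 := by
  rw [idem, idem, smul_mul_smul_comm, capCup_mul_capCup]
  split_ifs with h
  · rw [← h, smul_smul, mul_assoc, Ring.inverse_mul_cancel _ (isUnit_circleVal ha k), mul_one]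
  · rw [smul_zero]

include ha in
theorem capEntry_mul_idem_mul_cupEntry (k : ℕ) :
    capEntry a k * idem a k * cupEntry a k = circleVal a k • emptyWeb a := by
  rw [idem, mul_smul_comm, smul_mul_assoc, capEntry_mul_capCup_mul_cupEntry, smul_smul,
    Ring.inverse_mul_cancel_left _ _ (isUnit_circleVal ha k)]

section Quotients

variable {A : Type*} [NonUnitalRing A] [Module R A] [SMulCommClass R A A]

include ha in
theorem smul_map_emptyWeb_eq_zero [IsScalarTower R A A] (π : Schur a →ₙₐ[R] A) {k : ℕ} {r : R}
    (h : r • π (idem a k) = 0) : r • π (emptyWeb a) = 0 := by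
  refine (isUnit_circleVal ha k).smul_eq_zero.1 ?_
  calc
    circleVal a k • r • π (emptyWeb a)
      = r • π (capEntry a k * idem a k * cupEntry a k) := by
        rw [capEntry_mul_idem_mul_cupEntry ha, map_smul, smul_comm]
    _ = π (capEntry a k) * (r • π (idem a k)) * π (cupEntry a k) := by
      rw [map_mul, map_mul, mul_smul_comm, smul_mul_assoc]
    _ = 0 := by rw [h, mul_zero, zero_mul]

include ha in
theorem linearIndependent_map_idem [IsScalarTower R A A] (π : Schur a →ₙₐ[R] A)
    (hempty : ∀ r : R, r • π (emptyWeb a) = 0 → r = 0) :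
    LinearIndependent R fun k => π (idem a k) := by
  refine linearIndependent_of_orthogonal_idempotents (fun k => ?_) (fun k l hkl => ?_)
    fun k r h => hempty r (smul_map_emptyWeb_eq_zero ha π h)
  · rw [IsIdempotentElem, ← map_mul, idem_mul_idem ha, if_pos rfl]
  · exact (map_mul π _ _).symm.trans (by rw [idem_mul_idem ha, if_neg hkl, map_zero])

end Quotients

section Vanishing

variable {A : Type*} [NonUnitalRing A] [Module R A] (π : Schur a →ₙₐ[R] A)

theorem map_entry_comp {j k l : ℕ} (f : upDown a j ⟶ upDown a k) (g : upDown a k ⟶ upDown a l) :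
    π (entry a j l (f ≫ g)) = π (entry a k l g) * π (entry a j k f) := by
  rw [← map_mul, entry_mul_entry_self]

theorem map_entry_eq_zero_of_source {j k : ℕ} (h : π (idEntry a j) = 0)
    (f : upDown a j ⟶ upDown a k) : π (entry a j k f) = 0 := by
  rw [← Category.id_comp f, map_entry_comp, ← idEntry, h, mul_zero]

theorem map_entry_eq_zero_of_target {j k : ℕ} (h : π (idEntry a k) = 0)
    (f : upDown a j ⟶ upDown a k) : π (entry a j k f) = 0 := by
  rw [← Category.comp_id f, map_entry_comp, ← idEntry, h, zero_mul]

theorem map_eq_zero_of_idEntry (h : ∀ k, π (idEntry a k) = 0) (s : Schur a) : π s = 0 := by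
  induction s using induct with
  | h0 => exact map_zero π
  | h1 k l f => exact map_entry_eq_zero_of_source π (h k) f
  | h2 f g hf hg => rw [map_add, hf, hg, add_zero]

theorem map_webLowerRaise_eq_zero {j : ℕ} (h : ∀ i < j, π (idEntry a i) = 0) :
    π (entry a j j (webLowerRaise a j)) = 0 := by
  cases j with
  | zero => rw [webLowerRaise, map_zero, map_zero]
  | succ j =>
    rw [webLowerRaise, map_entry_comp, map_entry_eq_zero_of_source π (h j j.lt_succ_self), zero_mul]

include ha in
theorem map_iterRaise_eq_zero_of_succ {j m : ℕ} (hj : π (entry a j j (webLowerRaise a j)) = 0)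
    (hm : π (entry a j (j + (m + 1)) (iterRaise a j (m + 1))) = 0) :
    π (entry a j (j + m) (iterRaise a j m)) = 0 := by
  have hcoeff : IsUnit (symmQInt q (m + 1) • aInt a (2 * j + m)) := by
    rw [Algebra.smul_def]
    exact ((symmQInt_q_ne_zero m.succ_ne_zero).isUnit.map _).mul (ha _)
  have hsum : π (entry a j (j + m) (iterRaise a j (m + 1) ≫ webLower a (j + m))) = 0 := by
    refine (map_entry_comp π _ (webLower a (j + m))).trans ?_
    exact (congrArg _ hm).trans (mul_zero _)
  rw [iterRaise_succ_comp_webLower, map_add, map_add, map_entry_comp, hj, mul_zero, zero_add,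
    map_smul, map_smul] at hsum
  exact hcoeff.smul_eq_zero.1 hsum

include ha in
theorem map_idEntry_eq_zero_of_iterRaise {j m : ℕ}
    (hj : π (entry a j j (webLowerRaise a j)) = 0)
    (hm : π (entry a j (j + m) (iterRaise a j m)) = 0) : π (idEntry a j) = 0 := by
  induction m with
  | zero => exact hm
  | succ m ih => exact ih (map_iterRaise_eq_zero_of_succ ha π hj hm)

include ha in
theorem map_idEntry_eq_zero (h : ∀ᶠ k in Filter.atTop, π (idEntry a k) = 0) (j : ℕ) :
    π (idEntry a j) = 0 := by
  obtain ⟨N, hN⟩ := Filter.eventually_atTop.1 h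
  induction j using Nat.strong_induction_on with
  | _ j ih =>
    exact map_idEntry_eq_zero_of_iterRaise ha π (map_webLowerRaise_eq_zero π ih)
      (map_entry_eq_zero_of_target π (hN (j + N) (Nat.le_add_left N j)) _)

theorem eventually_idEntry_mul_eq_zero (s : Schur a) :
    ∀ᶠ k in Filter.atTop, idEntry a k * s = 0 := by
  induction s using induct with
  | h0 => exact Filter.Eventually.of_forall fun k => mul_zero _
  | h1 j l f =>
    filter_upwards [Filter.eventually_gt_atTop l] with k hk
    exact entry_mul_entry_of_ne a _ _ _ _ hk.ne _ _
  | h2 f g hf hg =>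
    filter_upwards [hf, hg] with k hkf hkg
    rw [mul_add, hkf, hkg, add_zero]

include ha in
theorem not_finite_of_surjective [SMulCommClass R A A] [Nontrivial A]
    (hπ : Function.Surjective π) : ¬ Module.Finite R A := by
  intro _
  have hmul : ∀ b, ∀ᶠ k in Filter.atTop, π (idEntry a k) * b = 0 := by
    rw [hπ.forall]
    intro s
    filter_upwards [eventually_idEntry_mul_eq_zero s] with k hk
    rw [← map_mul, hk, map_zero]
  have hlarge : ∀ᶠ k in Filter.atTop, π (idEntry a k) = 0 := by
    filter_upwards [eventually_forall_mul_eq_zero (R := R) hmul] with k hk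
    rw [idEntry, ← Category.comp_id (𝟙 (upDown a k)), map_entry_comp]
    exact hk _
  obtain ⟨b, hb⟩ := exists_ne (0 : A)
  obtain ⟨s, rfl⟩ := hπ b
  exact hb (map_eq_zero_of_idEntry π (map_idEntry_eq_zero ha π hlarge) s)

end Vanishing

end Schur

end SchurAlgebra

end QWeb

open QWeb in
theorem mainTheorem4_general {R : Type u} [CommRing R] [Algebra (RatFunc ℚ) R] (a : Rˣ)
    (ha : ∀ r, IsUnit (aInt a r)) :
    (∀ k : ℕ, webCup a k ≫ webCap a k = circleVal a k • 𝟙 (𝟙_ (InfWeb a)) ∧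
      IsUnit (circleVal a k)) ∧
    (∀ k l : ℕ, Schur.capCup a k * Schur.capCup a l =
      if k = l then circleVal a k • Schur.capCup a k else 0) ∧
    (∀ k l : ℕ, Schur.idem a k * Schur.idem a l = if k = l then Schur.idem a k else 0) ∧
    (∀ (A : Type v) [NonUnitalRing A] [Module R A] [IsScalarTower R A A] [SMulCommClass R A A]
      (π : Schur a →ₙₐ[R] A),
      ((∀ r : R, r • π (Schur.emptyWeb a) = 0 → r = 0) →
        LinearIndependent R fun k : ℕ => π (Schur.idem a k)) ∧
      (Function.Surjective π → Nontrivial A → ¬ Module.Finite R A)) :=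
  ⟨fun k => ⟨webCup_comp_webCap a k, isUnit_circleVal ha k⟩, Schur.capCup_mul_capCup a,
    Schur.idem_mul_idem ha, fun _ _ _ _ _ π =>
      ⟨Schur.linearIndependent_map_idem ha π, fun hπ _ => Schur.not_finite_of_surjective ha π hπ⟩⟩

open QWeb in
theorem mainTheorem4 {R : Type u} [CommRing R] [Algebra (RatFunc ℚ) R]
    (x : ℚ) (hx : ∀ n : ℕ, x ≠ n)
    (ν : R) (hν : ν ^ 2 * algebraMap (RatFunc ℚ) R (qDelta x) = 1) :
    -- the value of the `k`-labelled circle is invertible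
    (∀ k : ℕ, webCup (xParam x ν hν) k ≫ webCap (xParam x ν hν) k =
        circleVal (xParam x ν hν) k • 𝟙 (𝟙_ (XWeb x ν hν)) ∧
      IsUnit (circleVal (xParam x ν hν) k)) ∧
    -- the rescaled webs are orthogonal idempotents
    (∀ k l : ℕ, Schur.capCup (xParam x ν hν) k * Schur.capCup (xParam x ν hν) l =
      if k = l then circleVal (xParam x ν hν) k • Schur.capCup (xParam x ν hν) k else 0) ∧
    (∀ k l : ℕ, Schur.idem (xParam x ν hν) k * Schur.idem (xParam x ν hν) l =
      if k = l then Schur.idem (xParam x ν hν) k else 0) ∧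
    -- for every quotient algebra `A`
    (∀ (A : Type v) [NonUnitalRing A] [Module R A] [IsScalarTower R A A] [SMulCommClass R A A]
      (π : XSchur x ν hν →ₙₐ[R] A), Function.Surjective π →
      -- if the empty web is not torsion in `A`, the idempotents stay linearly independent
      ((∀ r : R, r • π (Schur.emptyWeb (xParam x ν hν)) = 0 → r = 0) →
        LinearIndependent R fun k : ℕ => π (Schur.idem (xParam x ν hν) k)) ∧
      -- if `A` is not zero, it is not finite-dimensional
      (Nontrivial A → ¬ Module.Finite R A)) := by
  obtain ⟨h₁, h₂, h₃, h₄⟩ :=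
    mainTheorem4_general (xParam x ν hν) fun r => isUnit_aInt_xParam (hx r) ν hν
  exact ⟨h₁, h₂, h₃, fun A _ _ _ _ π hπ => ⟨(h₄ A π).1, (h₄ A π).2 hπ⟩⟩
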